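/- Let $p$ be an odd prime, $q>3$ a power of $p$, and $F$ a field of characteristic $p$. A Lie algebra $L=\bigoplus_{i\ge1}L_i$ over $F$, graded over the positive integers, is \emph{of type 2} if $\dim L_i\le1$ for all $i$, the nonzero components are consecutive (if $L_i=0$ then $L_{i+1}=0$), $L$ is generated by $L_1$ and $L_2$, and $L$ is of maximal class, that is, the Lie power $L^{i}$ has codimension $i$ whenever $i\ge2$ and $L^{i-1}\ne0$; the infinite-dimensional algebras of type 2 are those with $\dim L_i=1$ for all $i\ge1$. For nonzero $e_1\in L_1$, $e_2\in L_2$ put $e_{i+1}=[e_i,e_1]$ for $i\ge2$. Define $\mu_q=1$, $\mu_{kq}=\tfrac12$ for $k\ge2$, $\mu_{kq+1}=-\tfrac12$ for $k\ge1$, and $\mu_n=0$ for all other $n\ge3$. Construction. Let $V$ be the vector space with basis $v_0,\dots,v_{q-1}$ over the field $F(t)$ of rational functions. Consider the semidirect product $V+\operatorname{End}(V)$, with endomorphisms written on the right, $[v,A]=vA$ and $V$ abelian. Let $E$ map $v_i\mapsto v_{i+1}$ for $i\neq q-1$ and $v_{q-1}\mapsto tv_0$; let $D$ map $v_0\mapsto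 v_2$, $v_{q-1}\mapsto -tv_1$, and $v_i\mapsto0$ otherwise. Let $L_0$ be the Lie algebra over $F$ generated by $e_1=E$ and $e_2=-\tfrac1{2t}v_1-\tfrac12D$ in $V+\operatorname{End}(V)$. Then: (1) $L_0$ has a grading for which it is an infinite-dimensional algebra of type 2 with $e_1$, $e_2$ nonzero of weight 1 and 2; it satisfies $[e_n,e_2]=\mu_ne_{n+2}$ for all $n\ge3$, and it is soluble. These relations define $L_0$: for every Lie algebra $K$ over $F$ with elements $x=e_1$, $y=e_2$ satisfying the same relations there is a unique homomorphism $L_0\to K$ with $e_1\mapsto x$, $e_2\mapsto y$. (2) Let $L$ be an infinite-dimensional algebra of type 2 over $F$ in which $[e_i,e_2]=0$ for $3\le i<q$ and $[e_q,e_2]\ne0$. After replacing $e_2$ by a nonzero scalar multiple, one has $[e_q,e_2]=e_{q+2}$ (and still $[e_i,e_2]=0$ for $3\le i<q$). (3) Let $L$ be an infinite-dimensional algebra of type 2 over $F$ in which $[e_i,e_2]=0$ for $3\le i<q$ and $[e_q,e_2]=e_{q+2}$. Then $[e_n,e_2]=\mu_ne_{n+2}$ for all $n\ge3$; that is, the remaining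 relations are $[e_{q+1},e_2]=-\tfrac12e_{q+3}$, $[e_{kq},e_2]=\tfrac12e_{kq+2}$ and $[e_{kq+1},e_2]=-\tfrac12e_{kq+3}$ for $k\ge2$, and all other $[e_n,e_2]$ with $n\ge3$ are zero. Moreover $[e_m,e_n]=0$ for $m,n>q$, $L$ is soluble, and there is an isomorphism $L\to L_0$ which maps each $e_i$ of $L$ to $e_i$ of $L_0$. So $L$ is unique. (4) Let $L$ be an algebra of type 2 over $F$, of finite or infinite dimension, let $n\ge1$, and suppose that $[e_k,e_2]=\mu_ke_{k+2}$ for $3\le k\le(2n-1)q+1$ and $[e_{2nq+1},e_2]=\lambda e_{2nq+3}$ with $\lambda\in F$. If $n=1$ and $e_{3q+3}\ne0$, or if $n\geq 1$ and $e_{(2n+2)q+2}\neq0$, then $\lambda=-\tfrac12$, or $\lambda=-\tfrac14$ and $p\ne3$. If $\lambda=-\tfrac14$, then $e_{(2n+p-2)q+2}=0$ and $L$ is nilpotent. -/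

import Mathlib

universe u v

noncomputable section

namespace ExtraLie

/-! ### Graded Lie algebras of maximal class, of type 2 -/

/-- The Lie algebra `L` with the grading `L = ⨁_{i ≥ 1} 𝒜 i` is an algebra of type 2, of finite or
infinite dimension: the homogeneous components have dimension at most one (and the nonzero ones
are consecutive, starting in weight 1), `L` is generated by `𝒜 1` and `𝒜 2`, and `L` is of maximal class.  The Lie power `L ^ i` is
`lowerCentralSeries F L L (i - 1)`; maximal class means that `L ^ i` has codimension `i` for
`2 ≤ i ≤ c + 1` if `L` is nilpotent of class `c`, and for all `i ≥ 2` otherwise; that is, for all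
`i = k + 2` such that `L ^ (k + 1)` is not zero. -/
structure IsTypeTwo (F : Type u) [Field F] {L : Type v} [LieRing L] [LieAlgebra F L]
    (𝒜 : ℕ → Submodule F L) : Prop where
  internal : DirectSum.IsInternal 𝒜
  zero_eq_bot : 𝒜 0 = ⊥
  lie_mem : ∀ (i j : ℕ) (x y : L), x ∈ 𝒜 i → y ∈ 𝒜 j → ⁅x, y⁆ ∈ 𝒜 (i + j)
  rank_le_one : ∀ i : ℕ, Module.rank F (𝒜 i) ≤ 1
  no_gap : ∀ i : ℕ, 1 ≤ i → 𝒜 i = ⊥ → 𝒜 (i + 1) = ⊥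
  generated : LieSubalgebra.lieSpan F L ((𝒜 1 : Set L) ∪ (𝒜 2 : Set L)) = ⊤
  maximal_class : ∀ k : ℕ, LieModule.lowerCentralSeries F L L k ≠ ⊥ →
    Module.finrank F (L ⧸ LieModule.lowerCentralSeries F L L (k + 1)) = k + 2

/-- An infinite-dimensional algebra of type 2: all components of positive weight are
one-dimensional. -/
structure IsInfiniteTypeTwo (F : Type u) [Field F] {L : Type v} [LieRing L] [LieAlgebra F L]
    (𝒜 : ℕ → Submodule F L) : Prop extends IsTypeTwo F 𝒜 where
  finrank_eq_one : ∀ i : ℕ, 1 ≤ i → Module.finrank F (𝒜 i) = 1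

/-- `x` and `y` are nonzero elements of weight 1 and 2. -/
structure IsStandardPair {F : Type u} [Field F] {L : Type v} [LieRing L] [LieAlgebra F L]
    (𝒜 : ℕ → Submodule F L) (x y : L) : Prop where
  fst_mem : x ∈ 𝒜 1
  fst_ne_zero : x ≠ 0
  snd_mem : y ∈ 𝒜 2
  snd_ne_zero : y ≠ 0

/-- The elements `e_1 = x`, `e_2 = y`, `e_{i+1} = [e_i, e_1]` for `i ≥ 2`. (The value at `0` is
not used.) -/
def stdSeq {L : Type v} [LieRing L] (x y : L) : ℕ → L
  | 0 => 0
  | 1 => x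
  | 2 => y
  | n + 3 => ⁅stdSeq x y (n + 2), x⁆

/-- The coefficients `μ_n` in the relations `[e_n, e_2] = μ_n e_{n+2}` (for `n ≥ 3`):
`μ_q = 1`, `μ_{kq} = 1/2` for `k ≥ 2`, `μ_{kq+1} = -1/2` for `k ≥ 1`, and `0` otherwise. -/
def extraCoeff (F : Type u) [Field F] (q n : ℕ) : F :=
  if n = q then 1
  else if n % q = 0 then 1 / 2
  else if n % q = 1 then -(1 / 2)
  else 0

/-! ### The semidirect product of a vector space with its endomorphism algebra -/

/-- `V + End(V)`, as a set of pairs `(v, A)`. -/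
@[ext]
structure SemiEnd (K : Type u) (V : Type v) [Field K] [AddCommGroup V] [Module K V] where
  vec : V
  op : Module.End K V

namespace SemiEnd

section

variable {K : Type u} {V : Type v} [Field K] [AddCommGroup V] [Module K V]

/-- The underlying set of pairs. -/
def toProd : SemiEnd K V ≃ V × Module.End K V where
  toFun a := (a.vec, a.op)
  invFun a := ⟨a.1, a.2⟩
  left_inv _ := rfl
  right_inv _ := rfl

instance : AddCommGroup (SemiEnd K V) := toProd.addCommGroup

/-- Endomorphisms are written on the right: `[v, A] = vA`, which is `A v` in functional notation,
`[A, B]` is "first `A`, then `B`" minus "first `B`, then `A`", and `V` is abelian. -/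
instance : Bracket (SemiEnd K V) (SemiEnd K V) where
  bracket a b := ⟨b.op a.vec - a.op b.vec, b.op * a.op - a.op * b.op⟩

@[simp] theorem vec_add (a b : SemiEnd K V) : (a + b).vec = a.vec + b.vec := rfl
@[simp] theorem op_add (a b : SemiEnd K V) : (a + b).op = a.op + b.op := rfl
@[simp] theorem vec_zero : (0 : SemiEnd K V).vec = 0 := rfl
@[simp] theorem op_zero : (0 : SemiEnd K V).op = 0 := rfl
@[simp] theorem vec_lie (a b : SemiEnd K V) : ⁅a, b⁆.vec = b.op a.vec - a.op b.vec := rfl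
@[simp] theorem op_lie (a b : SemiEnd K V) : ⁅a, b⁆.op = b.op * a.op - a.op * b.op := rfl

instance : LieRing (SemiEnd K V) where
  add_lie a b c := by
    ext1
    · simp only [vec_lie, vec_add, op_add, map_add, LinearMap.add_apply]; abel
    · simp only [op_lie, op_add]; noncomm_ring
  lie_add a b c := by
    ext1
    · simp only [vec_lie, vec_add, op_add, map_add, LinearMap.add_apply]; abel
    · simp only [op_lie, op_add]; noncomm_ring
  lie_self a := by
    ext1
    · simp
    · simp
  leibniz_lie a b c := by
    ext1
    · simp only [vec_lie, vec_add, op_lie, map_sub, LinearMap.sub_apply, Module.End.mul_apply]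
      abel
    · simp only [op_lie, op_add]; noncomm_ring

variable {F : Type u} [Field F] [Algebra F K] [Module F V] [IsScalarTower F K V]

instance : Module F (SemiEnd K V) := toProd.module F

@[simp] theorem vec_smul (c : F) (a : SemiEnd K V) : (c • a).vec = c • a.vec := rfl
@[simp] theorem op_smul (c : F) (a : SemiEnd K V) : (c • a).op = c • a.op := rfl

instance : LieAlgebra F (SemiEnd K V) where
  lie_smul c a b := by
    ext1
    · simp only [vec_lie, vec_smul, op_smul, LinearMap.smul_apply, smul_sub]
      rw [LinearMap.map_smul_of_tower]
    · simp only [op_lie, op_smul, smul_sub, smul_mul_assoc, mul_smul_comm]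

end

end SemiEnd

/-! ### The algebra with first constituent of length `q` -/

/-- The vector `v_i` of the standard basis `v_0, …, v_{q-1}` of `F(t)^q`. -/
def vecV (F : Type u) [Field F] (q i : ℕ) : Fin q → RatFunc F :=
  fun j => if (j : ℕ) = i then 1 else 0

/-- `E` maps `v_i` to `v_{i+1}` for `i ≠ q - 1`, and `v_{q-1}` to `t v_0`. -/
def opE (F : Type u) [Field F] (q : ℕ) : Module.End (RatFunc F) (Fin q → RatFunc F) :=
  (Pi.basisFun (RatFunc F) (Fin q)).constr (RatFunc F) fun j =>
    if (j : ℕ) = q - 1 then (RatFunc.X : RatFunc F) • vecV F q 0 else vecV F q (j + 1)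

/-- `D` maps `v_0` to `v_2`, `v_{q-1}` to `-t v_1`, and the other basis vectors to `0`. -/
def opD (F : Type u) [Field F] (q : ℕ) : Module.End (RatFunc F) (Fin q → RatFunc F) :=
  (Pi.basisFun (RatFunc F) (Fin q)).constr (RatFunc F) fun j =>
    if (j : ℕ) = 0 then vecV F q 2
    else if (j : ℕ) = q - 1 then -((RatFunc.X : RatFunc F) • vecV F q 1)
    else 0

/-- `e_1 = E` in `V + End(V)`. -/
def genOne (F : Type u) [Field F] (q : ℕ) : SemiEnd (RatFunc F) (Fin q → RatFunc F) :=
  ⟨0, opE F q⟩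

/-- `e_2 = -(1/(2t)) v_1 - (1/2) D` in `V + End(V)`. -/
def genTwo (F : Type u) [Field F] (q : ℕ) : SemiEnd (RatFunc F) (Fin q → RatFunc F) :=
  ⟨-((1 / (2 * RatFunc.X) : RatFunc F) • vecV F q 1), -((1 / 2 : RatFunc F) • opD F q)⟩

/-- The Lie algebra over `F` generated by `e_1` and `e_2` in `V + End(V)`, where `V = F(t)^q`. -/
def extraAlgebra (F : Type u) [Field F] (q : ℕ) :
    LieSubalgebra F (SemiEnd (RatFunc F) (Fin q → RatFunc F)) :=
  LieSubalgebra.lieSpan F _ {genOne F q, genTwo F q}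

/-- `e_1` as an element of `extraAlgebra F q`. -/
def extraOne (F : Type u) [Field F] (q : ℕ) : extraAlgebra F q :=
  ⟨genOne F q, LieSubalgebra.subset_lieSpan (by simp)⟩

/-- `e_2` as an element of `extraAlgebra F q`. -/
def extraTwo (F : Type u) [Field F] (q : ℕ) : extraAlgebra F q :=
  ⟨genTwo F q, LieSubalgebra.subset_lieSpan (by simp)⟩

end ExtraLie

end

noncomputable section

namespace ExtraLie

/-! All information about an algebra of type 2 sits in the scalars β_k with [e_k, e_2] = β_k
e_{k+2}. By the Leibniz rule [e_m, e_{k+2}] is e_{m+k+2} times the k-th difference of β at m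
(`stdSeq_lie_stdSeq`). As long as e_N ≠ 0, anticommutativity and the Jacobi identity for e_m,
e_{k+2}, e_2 become polynomial equations for β (`IsLieSeq`), and the classification consists in
solving them. A k-th difference is the value of the functional X^i ↦ β_i at X^m (1 - X)^k. In
characteristic p the orders q and q - 1 are therefore short: (1 - X)^q = 1 - X^q and (1 - X)^(q-1) =
1 + X + … + X^(q-1).

Cut β into levels of length q starting at the multiples of q. The Jacobi identity carries the
vanishing of the interior of one level over to the next (`IsLieSeq.eq_zero_of_ne_zero`,
`IsLieSeq.next_level`), so a level is described by its first two coefficients. Once β is standard up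
to weight 2nq, everything depends on l = β_{2nq+1}. Elimination of the other unknowns leaves l =
-1/2 or l = -1/4 (`IsLieSeq.eq_or_eq`). The value -1/2 continues the standard pattern. The value
-1/4 forces the levels 2n, 2n+1, 2n+2, … to start with 1/2, 1/3, 1/4, …, which breaks down at 1/p
(`IsLieSeq.quarter_chain`, `IsLieSeq.lt_of_eq_neg_quarter`). In infinite dimension only -1/2
remains.

For existence, number the vectors t^(c-1) v_r as w_{cq+r}. Then E is the shift and D is a weighted
shift with q-periodic weights. The operator part of e_{k+2} has -1/2 times the k-th differences of
these weights, and they vanish from order q - 1 on. The relations reduce to two identities for the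
weights (`opCoeff_sub_lieCoeff`, `lieCoeff_opCoeff_mul`). Since the e_i form a basis, the relations
present the algebra (`existsUnique_lieHom`), and uniqueness up to isomorphism follows. Maximal class
enters through `IsTypeTwo.stdSeq_ne_zero`: it makes e_i span every nonzero component. -/

/-! ### Iterated differences -/

section Coefficients

variable {F : Type u} [Field F]

/-- Iterated differences of a sequence: if `[e_k, e_2] = β_k e_{k+2}` for all `k`, then
`[e_m, e_{k+2}]` is `lieCoeff β k m` times `e_{m+k+2}`. -/
def lieCoeff (β : ℕ → F) : ℕ → ℕ → F
  | 0 => β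
  | k + 1 => fun m => lieCoeff β k m - lieCoeff β k (m + 1)

@[simp] theorem lieCoeff_zero (β : ℕ → F) (m : ℕ) : lieCoeff β 0 m = β m := rfl

theorem lieCoeff_succ (β : ℕ → F) (k m : ℕ) :
    lieCoeff β (k + 1) m = lieCoeff β k m - lieCoeff β k (m + 1) := rfl

theorem lieCoeff_one (β : ℕ → F) (m : ℕ) : lieCoeff β 1 m = β m - β (m + 1) := rfl

/-- The linear functional on polynomials with `X ^ k ↦ β k`. -/
def seqFunctional (β : ℕ → F) : Polynomial F →ₗ[F] F :=
  Polynomial.lsum fun k => LinearMap.lsmul F F (β k)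

theorem seqFunctional_X_pow (β : ℕ → F) (k : ℕ) :
    seqFunctional β (Polynomial.X ^ k) = β k := by
  simp [seqFunctional, Polynomial.X_pow_eq_monomial, Polynomial.sum_monomial_index]

-- A factor 1 - X under the functional is exactly one difference, so identities between differences
-- become identities between polynomials.
open Polynomial in
theorem lieCoeff_eq_seqFunctional (β : ℕ → F) (k m : ℕ) :
    lieCoeff β k m = seqFunctional β (X ^ m * (1 - X) ^ k) := by
  induction k generalizing m with
  | zero => simp [seqFunctional_X_pow]
  | succ k ih =>
    rw [lieCoeff_succ, ih, ih, ← map_sub]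
    congr 1
    ring

-- The Frobenius identity (1 - X)^(p^s) = 1 - X^(p^s): a difference of order p^s is a single
-- difference with step p^s.
open Polynomial in
theorem lieCoeff_add_char_pow (p s : ℕ) [Fact p.Prime] [CharP F p] (β : ℕ → F) (k m : ℕ) :
    lieCoeff β (k + p ^ s) m = lieCoeff β k m - lieCoeff β k (m + p ^ s) := by
  have h : (1 - X : F[X]) ^ p ^ s = 1 - X ^ p ^ s := by
    rw [sub_pow_char_pow, one_pow]
  rw [lieCoeff_eq_seqFunctional, lieCoeff_eq_seqFunctional, lieCoeff_eq_seqFunctional, ← map_sub,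
    pow_add, h]
  congr 1
  ring

-- (1 - X)^(p^s - 1) is the geometric sum of length p^s, because both become 1 - X^(p^s) after
-- multiplication by 1 - X.
open Polynomial in
theorem lieCoeff_char_pow_sub_one (p s : ℕ) [Fact p.Prime] [CharP F p] (β : ℕ → F) (m : ℕ) :
    lieCoeff β (p ^ s - 1) m = ∑ j ∈ Finset.range (p ^ s), β (m + j) := by
  have hX : (1 - X : F[X]) ≠ 0 := by
    intro h
    have := congrArg (eval 0) h
    simp at this
  have h : (1 - X : F[X]) ^ (p ^ s - 1) = ∑ j ∈ Finset.range (p ^ s), X ^ j := by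
    apply mul_right_cancel₀ hX
    have := geom_sum_mul_neg (X : F[X]) (p ^ s)
    rw [this, ← pow_succ, Nat.sub_add_cancel (Nat.one_le_pow _ _ (Fact.out : p.Prime).pos),
      sub_pow_char_pow, one_pow]
  rw [lieCoeff_eq_seqFunctional, h, Finset.mul_sum, map_sum]
  refine Finset.sum_congr rfl fun j _ => ?_
  rw [← pow_add, seqFunctional_X_pow]

/-- This and the next evaluations are the binomial expansion of a difference in which few entries
survive. Since the interiors of levels vanish, they cover most brackets that occur later. -/
theorem lieCoeff_eq_zero (β : ℕ → F) (k m : ℕ) (h : ∀ j ≤ k, β (m + j) = 0) :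
    lieCoeff β k m = 0 := by
  induction k generalizing m with
  | zero => simpa using h 0 le_rfl
  | succ k ih =>
    rw [lieCoeff_succ, ih m fun j hj => h j (by omega), ih (m + 1) fun j hj => ?_, sub_zero]
    rw [add_assoc]
    exact h (1 + j) (by omega)

theorem lieCoeff_eq_head (β : ℕ → F) (k m : ℕ) (h : ∀ j, 1 ≤ j → j ≤ k → β (m + j) = 0) :
    lieCoeff β k m = β m := by
  induction k with
  | zero => rfl
  | succ k ih =>
    rw [lieCoeff_succ, ih fun j h1 h2 => h j h1 (by omega), lieCoeff_eq_zero, sub_zero]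
    intro j hj
    rw [add_assoc]
    exact h (1 + j) (by omega) (by omega)

theorem lieCoeff_eq_head_two (β : ℕ → F) (k m : ℕ) (h : ∀ j, 2 ≤ j → j ≤ k → β (m + j) = 0) :
    lieCoeff β k m = β m - k * β (m + 1) := by
  induction k with
  | zero => simp
  | succ k ih =>
    rw [lieCoeff_succ, ih fun j h1 h2 => h j h1 (by omega), lieCoeff_eq_head β k (m + 1)]
    · push_cast; ring
    intro j h1 h2
    rw [add_assoc]
    exact h (1 + j) (by omega) (by omega)

/-- The factor 2 clears the denominator of the binomial coefficient k(k - 1)/2. -/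
theorem lieCoeff_eq_head_three (β : ℕ → F) (k m : ℕ) (h0 : β m = 0)
    (h : ∀ j, 3 ≤ j → j ≤ k → β (m + j) = 0) :
    2 * lieCoeff β k m = -(2 * k * β (m + 1)) + k * (k - 1) * β (m + 2) := by
  induction k with
  | zero => simp [h0]
  | succ k ih =>
    rw [lieCoeff_succ, mul_sub, ih fun j h1 h2 => h j h1 (by omega),
      lieCoeff_eq_head_two β k (m + 1)]
    · push_cast; ring
    intro j h1 h2
    rw [add_assoc]
    exact h (1 + j) (by omega) (by omega)

theorem lieCoeff_eq_last (β : ℕ → F) (k m : ℕ) (h : ∀ j < k, β (m + j) = 0) :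
    lieCoeff β k m = (-1) ^ k * β (m + k) := by
  induction k generalizing m with
  | zero => simp
  | succ k ih =>
    rw [lieCoeff_succ, lieCoeff_eq_zero β k m fun j hj => h j (by omega),
      ih (m + 1) fun j hj => ?_]
    · rw [add_assoc, add_comm 1 k]; ring
    rw [add_assoc]
    exact h (1 + j) (by omega)

theorem lieCoeff_eq_last_two (β : ℕ → F) (k m : ℕ) (h : ∀ j < k, β (m + j) = 0) :
    lieCoeff β (k + 1) m = (-1) ^ k * ((k + 1) * β (m + k) - β (m + k + 1)) := by
  induction k generalizing m with
  | zero => simp [lieCoeff_one]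
  | succ k ih =>
    rw [lieCoeff_succ, lieCoeff_eq_last β (k + 1) m fun j hj => h j (by omega),
      ih (m + 1) fun j hj => ?_]
    · rw [show m + 1 + k = m + (k + 1) by ring]; push_cast; ring
    rw [add_assoc]
    exact h (1 + j) (by omega)

/-- An iterated difference of a sequence which is constant up to its last two terms. -/
theorem lieCoeff_of_const (f : ℕ → F) (A : F) (k m : ℕ) (h : ∀ j < k, f (m + j) = A) :
    lieCoeff f (k + 1) m =
      (-1) ^ k * ((k + 1) * (f (m + k) - A) - (f (m + k + 1) - A)) := by
  -- Differences of positive order do not see an additive constant, so A may be subtracted.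
  have hA : ∀ k m, lieCoeff f (k + 1) m = lieCoeff (fun i => f i - A) (k + 1) m := by
    intro k
    induction k with
    | zero => intro m; simp [lieCoeff_one]
    | succ k ih => intro m; rw [lieCoeff_succ, ih, ih, ← lieCoeff_succ]
  rw [hA, lieCoeff_eq_last_two]
  intro j hj
  simp [h j hj]

/-- Iterated differences with step `q`. -/
theorem lieCoeff_mul_char_pow_add (p s : ℕ) [Fact p.Prime] [CharP F p] (β : ℕ → F)
    (i k m : ℕ) :
    lieCoeff β (k + i * p ^ s) m = lieCoeff (fun j => lieCoeff β k (m + j * p ^ s)) i 0 := by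
  have h : ∀ l, lieCoeff β (k + i * p ^ s) (m + l * p ^ s) =
      lieCoeff (fun j => lieCoeff β k (m + j * p ^ s)) i l := by
    induction i with
    | zero => intro l; simp
    | succ i ih =>
      intro l
      rw [lieCoeff_succ, ← ih, ← ih, show k + (i + 1) * p ^ s = k + i * p ^ s + p ^ s by ring,
        lieCoeff_add_char_pow]
      congr 2
      ring
  simpa using h 0

/-- The conditions that the Lie algebra axioms impose on the coefficients in
`[e_k, e_2] = β_k e_{k+2}` when `e_N ≠ 0`. -/
structure IsLieSeq (β : ℕ → F) (N : ℕ) : Prop where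
  two : β 2 = 0
  antisymm : ∀ m n, 2 ≤ m → 2 ≤ n → m + n ≤ N → lieCoeff β (n - 2) m = -lieCoeff β (m - 2) n
  jacobi : ∀ m k, 2 ≤ m → m + k + 4 ≤ N →
    lieCoeff β k m * β (m + k + 2) =
      β m * lieCoeff β k (m + 2) + β (k + 2) * lieCoeff β (k + 2) m

theorem IsLieSeq.mono {β : ℕ → F} {N M : ℕ} (h : IsLieSeq β N) (hM : M ≤ N) : IsLieSeq β M where
  two := h.two
  antisymm m n hm hn hmn := h.antisymm m n hm hn (hmn.trans hM)
  jacobi m k hm hk := h.jacobi m k hm (hk.trans hM)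

end Coefficients

/-! ### Equations for β along one level of length q -/

section Levels

variable {F : Type u} [Field F]

/-- `q > 3` is a power of the odd characteristic `p` of `F`. -/
structure IsOddCharPower (F : Type u) [Field F] (p q : ℕ) : Prop where
  prime : p.Prime
  ne_two : p ≠ 2
  char : CharP F p
  eq_pow : ∃ s, q = p ^ s
  three_lt : 3 < q

namespace IsOddCharPower

variable {p q : ℕ}

theorem odd (h : IsOddCharPower F p q) : Odd q := by
  obtain ⟨s, rfl⟩ := h.eq_pow
  exact (h.prime.odd_of_ne_two h.ne_two).pow

theorem five_le (h : IsOddCharPower F p q) : 5 ≤ q := by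
  obtain ⟨k, hk⟩ := h.odd
  have := h.three_lt
  omega

theorem two_ne_zero (h : IsOddCharPower F p q) : (2 : F) ≠ 0 := by
  have := h.char
  intro h2
  have h2' : ((2 : ℕ) : F) = 0 := by exact_mod_cast h2
  rw [CharP.cast_eq_zero_iff F p] at h2'
  exact h.ne_two ((Nat.prime_dvd_prime_iff_eq h.prime Nat.prime_two).mp h2')

theorem cast_eq_zero (h : IsOddCharPower F p q) : (q : F) = 0 := by
  have := h.char
  obtain ⟨s, hs⟩ := h.eq_pow
  have h0 : s ≠ 0 := by
    rintro rfl
    have := h.three_lt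
    simp at hs
    omega
  rw [CharP.cast_eq_zero_iff F p, hs]
  exact dvd_pow_self p h0

theorem lieCoeff_add (h : IsOddCharPower F p q) (β : ℕ → F) (k m : ℕ) :
    lieCoeff β (k + q) m = lieCoeff β k m - lieCoeff β k (m + q) := by
  have := h.char
  have := Fact.mk h.prime
  obtain ⟨s, rfl⟩ := h.eq_pow
  exact lieCoeff_add_char_pow p s β k m

theorem lieCoeff_mul_add (h : IsOddCharPower F p q) (β : ℕ → F) (i k m : ℕ) :
    lieCoeff β (k + i * q) m = lieCoeff (fun j => lieCoeff β k (m + j * q)) i 0 := by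
  have := h.char
  have := Fact.mk h.prime
  obtain ⟨s, rfl⟩ := h.eq_pow
  exact lieCoeff_mul_char_pow_add p s β i k m

theorem lieCoeff_pred (h : IsOddCharPower F p q) (β : ℕ → F) (m a b : ℕ) (hma : m ≤ a)
    (hab : a < b) (hb : b < m + q)
    (h0 : ∀ i, m ≤ i → i < m + q → i ≠ a → i ≠ b → β i = 0) :
    lieCoeff β (q - 1) m = β a + β b := by
  have := h.char
  have := Fact.mk h.prime
  obtain ⟨s, rfl⟩ := h.eq_pow
  rw [lieCoeff_char_pow_sub_one p s β m, Finset.sum_eq_add (a - m) (b - m)]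
  · rw [show m + (a - m) = a by omega, show m + (b - m) = b by omega]
  · omega
  · intro c hc hne
    rw [Finset.mem_range] at hc
    exact h0 _ (by omega) (by omega) (by omega) (by omega)
  · intro hn
    rw [Finset.mem_range] at hn
    omega
  · intro hn
    rw [Finset.mem_range] at hn
    omega

end IsOddCharPower

variable {p q : ℕ} {β : ℕ → F} {N : ℕ}

/-- Anticommutativity of e_2 and e_{q+1}: the difference of order q - 1 at 2 is the sum β_2 + … +
β_{q+1} = 1 + β_{q+1}, and it has to equal -β_{q+1}. -/
theorem IsLieSeq.value_succ (hF : IsOddCharPower F p q) (H : IsLieSeq β N) (hN : q + 3 ≤ N)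
    (low : ∀ i, 2 ≤ i → i < q → β i = 0) (one : β q = 1) : β (q + 1) = -(1 / 2) := by
  have h2 := hF.two_ne_zero
  have h5 := hF.five_le
  have h := H.antisymm 2 (q + 1) (by omega) (by omega) (by omega)
  rw [show q + 1 - 2 = q - 1 by omega, hF.lieCoeff_pred β 2 q (q + 1) (by omega) (by omega)
    (by omega) fun i h1 h3 h4 h6 => low i h1 (by omega), one] at h
  simp only [Nat.sub_self, lieCoeff_zero] at h
  field_simp
  linear_combination h

/-- The coefficients `β_2, …, β_{2q-1}` are those of the algebra with first constituent of
length `q`. -/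
structure IsExtraStart (β : ℕ → F) (q : ℕ) : Prop where
  low : ∀ i, 2 ≤ i → i < q → β i = 0
  one : β q = 1
  succ : β (q + 1) = -(1 / 2)
  gap : ∀ i, q + 2 ≤ i → i < 2 * q → β i = 0

/-- The first level: the coefficients `β_{q+2}, …, β_{2q}`. -/
theorem IsLieSeq.first_gap (hF : IsOddCharPower F p q) (H : IsLieSeq β N)
    (low : ∀ i, 2 ≤ i → i < q → β i = 0) (one : β q = 1) (succ : β (q + 1) = -(1 / 2))
    (k : ℕ) (hk2 : 2 ≤ k) (hkq : k < q) (hN : q + k + 2 ≤ N) : β (q + k) = 0 := by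
  have h2 := hF.two_ne_zero
  have h5 := hF.five_le
  induction k using Nat.strong_induction_on with
  | _ k ih =>
  have gap : ∀ i, q + 2 ≤ i → i < q + k → β i = 0 := by
    intro i h1 h3
    have := ih (i - q) (by omega) (by omega) (by omega) (by omega)
    rwa [show q + (i - q) = i by omega] at this
  -- The parity decides which identity carries a sign that does not cancel. For odd k it is
  -- anticommutativity of e_2 and e_{q+k}; for even k ≥ 4 it is Jacobi for e_{q+1}, e_{k-1}, e_2.
  -- For k = 2 the latter makes no sense, and e_{q-1}, e_3, e_2 are used.
  rcases Nat.even_or_odd k with hev | hodd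
  · rcases Nat.lt_or_ge k 3 with hk3 | hk3
    · obtain rfl : k = 2 := by omega
      have h := H.jacobi (q - 1) 1 (by omega) (by omega)
      rw [lieCoeff_one, show q - 1 + 1 = q by omega,
        low (q - 1) (by omega) (by omega), one, low (1 + 2) (by omega) (by omega)] at h
      linear_combination -h
    · obtain ⟨k, rfl⟩ : ∃ l, k = l + 3 := ⟨k - 3, by omega⟩
      have h := H.jacobi (q + 1) k (by omega) (by omega)
      rw [low (k + 2) (by omega) (by omega),
        lieCoeff_eq_head β k (q + 1) fun j h1 h3 => gap _ (by omega) (by omega),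
        lieCoeff_eq_last β k (q + 1 + 2) fun j h3 => gap _ (by omega) (by omega),
        show q + 1 + k + 2 = q + (k + 3) by omega, show q + 1 + 2 + k = q + (k + 3) by omega,
        Odd.neg_one_pow (by rcases hev with ⟨l, hl⟩; exact ⟨l - 2, by omega⟩), succ] at h
      have h' : 2 * β (q + (k + 3)) = 0 := by
        field_simp at h
        linear_combination -h
      simpa [h2] using h'
  · obtain ⟨k, rfl⟩ : ∃ l, k = l + 2 := ⟨k - 2, by omega⟩
    have h := H.antisymm 2 (q + (k + 2)) (by omega) (by omega) (by omega)
    rw [show q + (k + 2) - 2 = k + q by omega, hF.lieCoeff_add,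
      lieCoeff_eq_zero β k 2 fun j h3 => low _ (by omega) (by omega),
      lieCoeff_eq_last β k (2 + q) fun j h3 => gap _ (by omega) (by omega),
      show 2 + q + k = q + (k + 2) by omega,
      Odd.neg_one_pow (by rcases hodd with ⟨l, hl⟩; exact ⟨l - 1, by omega⟩)] at h
    simp only [Nat.sub_self, lieCoeff_zero] at h
    have h' : 2 * β (q + (k + 2)) = 0 := by linear_combination h
    simpa [h2] using h'


theorem IsLieSeq.isExtraStart (hF : IsOddCharPower F p q) (H : IsLieSeq β N) (hN : 2 * q + 1 ≤ N)
    (low : ∀ i, 2 ≤ i → i < q → β i = 0) (one : β q = 1) (succ : β (q + 1) = -(1 / 2)) :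
    IsExtraStart β q := by
  refine ⟨low, one, succ, fun i h1 h3 => ?_⟩
  have := H.first_gap hF low one succ (i - q) (by omega) (by omega) (by omega)
  rwa [show q + (i - q) = i by omega] at this

/-- The coefficient of [e_{q+1}, e_{q+1}] = 0 is the sum β_{q+1} + … + β_{2q}, of which only the two
ends survive. -/
theorem IsLieSeq.value_two_mul (hF : IsOddCharPower F p q) (H : IsLieSeq β N)
    (hN : 2 * q + 2 ≤ N) (S : IsExtraStart β q) : β (2 * q) = 1 / 2 := by
  have h2 := hF.two_ne_zero
  have h5 := hF.five_le
  have h := H.antisymm (q + 1) (q + 1) (by omega) (by omega) (by omega)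
  rw [show q + 1 - 2 = q - 1 by omega, hF.lieCoeff_pred β (q + 1) (q + 1) (2 * q) (by omega)
    (by omega) (by omega) fun i h1 h3 h4 h6 => S.gap i (by omega) (by omega), S.succ] at h
  have h' : 2 * (2 * β (2 * q)) = 2 := by
    field_simp at h
    linear_combination h
  field_simp
  exact mul_left_cancel₀ h2 (by linear_combination h')

/-- If `β_t ≠ 0` for some `t` at the end of a level, then the coefficients in the interior of the
level vanish up to `β_{t-2}`. -/
theorem IsLieSeq.eq_zero_of_ne_zero (hF : IsOddCharPower F p q) (H : IsLieSeq β N)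
    (S : IsExtraStart β q) {b t : ℕ} (hint : ∀ i, b + 2 ≤ i → i < b + q → β i = 0)
    (htb : t ≤ b + 2 * q) (ht : β t ≠ 0) (hN : t + 2 ≤ N) (i : ℕ) (hi : b + q + 2 ≤ i)
    (hit : i + 2 ≤ t) : β i = 0 := by
  have h5 := hF.five_le
  obtain ⟨k, hk⟩ : ∃ k, t = i + k + 2 := ⟨t - i - 2, by omega⟩
  induction k using Nat.strong_induction_on generalizing i with
  | _ k ih =>
  have hz : ∀ j, i < j → j + 2 ≤ t → β j = 0 := fun j h1 h3 =>
    ih (t - j - 2) (by omega) j (by omega) h3 (by omega)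
  obtain ⟨m, rfl⟩ : ∃ m, i = m + q := ⟨i - q, by omega⟩
  -- Descending induction on i, with k = t - i - 2. In Jacobi for e_{i-q}, e_{t-i+q}, e_2 both terms
  -- on the right vanish. By the Frobenius rule the left factor is -β_i, as the coefficients after i
  -- up to t - 2 are already known to be zero.
  have h := H.jacobi m (k + q) (by omega) (by omega)
  rw [show m + (k + q) + 2 = t by omega, hint m (by omega) (by omega),
    S.gap (k + q + 2) (by omega) (by omega), hF.lieCoeff_add,
    lieCoeff_eq_zero β k m fun j h3 => hint _ (by omega) (by omega),
    lieCoeff_eq_head β k (m + q) fun j h1 h3 => hz _ (by omega) (by omega)] at h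
  have h' : β (m + q) * β t = 0 := by linear_combination -h
  simpa [ht] using h'

/-- The end of a level: if `β_{a+q-1} ≠ 0`, where `a = b + q`, then the coefficients satisfy three
equations. -/
theorem IsLieSeq.last_equations (hF : IsOddCharPower F p q) (H : IsLieSeq β N)
    (S : IsExtraStart β q) {b : ℕ} (hint : ∀ i, b + 2 ≤ i → i < b + q → β i = 0)
    (hN : b + 2 * q + 1 ≤ N) (hlast : β (b + 2 * q - 1) ≠ 0) :
    (2 * β (b + q) + 2 * β (b + q + 1) + 1) * β (b + 2 * q - 1) = β (b + 2 * q - 2) ∧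
    2 * β (b + q) + 3 * β (b + q + 1) + 1 = 0 ∧
    3 * β (b + q + 1) * β (b + 2 * q - 1) = 3 * β (b + q) * β (b + 2 * q - 2) := by
  have h2 := hF.two_ne_zero
  have h5 := hF.five_le
  have hq0 := hF.cast_eq_zero
  have hz : ∀ i, b + q + 2 ≤ i → i + 2 < b + 2 * q → β i = 0 := fun i h1 h3 =>
    H.eq_zero_of_ne_zero hF S hint (by omega) hlast (by omega) i h1 (by omega)
  -- With a = b + q, these are the Jacobi identities with e_2 for (e_{a-2}, e_{q+1}), (e_{a-1}, e_q)
  -- and (e_a, e_{q-1}). All three have β_{a+q-1} as the factor on the left.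
  refine ⟨?_, ?_, ?_⟩
  · have h := H.jacobi (b + q - 2) (q - 1) (by omega) (by omega)
    rw [hF.lieCoeff_pred β (b + q - 2) (b + q) (b + q + 1) (by omega) (by omega) (by omega)
        fun i h1 h3 h4 h6 => (Nat.lt_or_ge i (b + q)).elim
          (fun h => hint i (by omega) h) (fun h => hz i (by omega) (by omega)),
      show b + q - 2 + (q - 1) + 2 = b + 2 * q - 1 by omega,
      hint (b + q - 2) (by omega) (by omega), show q - 1 + 2 = 1 + q by omega,
      hF.lieCoeff_add, lieCoeff_one, lieCoeff_one, add_comm 1 q, S.succ,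
      hint (b + q - 2) (by omega) (by omega), hint (b + q - 2 + 1) (by omega) (by omega),
      show b + q - 2 + q = b + 2 * q - 2 by omega,
      show b + 2 * q - 2 + 1 = b + 2 * q - 1 by omega] at h
    field_simp at h
    linear_combination h
  · have h := H.jacobi (b + q - 1) (q - 2) (by omega) (by omega)
    have h3 := lieCoeff_eq_head_three β (q - 2) (b + q - 1) (hint _ (by omega) (by omega))
      fun j h1 h3 => hz _ (by omega) (by omega)
    rw [show b + q - 1 + (q - 2) + 2 = b + 2 * q - 1 by omega,
      hint (b + q - 1) (by omega) (by omega), show q - 2 + 2 = 0 + q by omega,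
      hF.lieCoeff_add, lieCoeff_zero, lieCoeff_zero, zero_add, S.one,
      hint (b + q - 1) (by omega) (by omega),
      show b + q - 1 + q = b + 2 * q - 1 by omega] at h
    rw [show b + q - 1 + 1 = b + q by omega, show b + q - 1 + 2 = b + q + 1 by omega,
      Nat.cast_sub (by omega), hq0] at h3
    have h4 : lieCoeff β (q - 2) (b + q - 1) = -1 :=
      mul_right_cancel₀ hlast (by linear_combination h)
    rw [h4] at h3
    push_cast at h3
    exact mul_left_cancel₀ h2 (by linear_combination -h3)
  · have h := H.jacobi (b + q) (q - 3) (by omega) (by omega)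
    rw [show b + q + (q - 3) + 2 = b + 2 * q - 1 by omega,
      S.low (q - 3 + 2) (by omega) (by omega),
      lieCoeff_eq_head_two β (q - 3) (b + q) fun j h1 h3 => hz _ (by omega) (by omega),
      show q - 3 = (q - 4) + 1 by omega,
      lieCoeff_eq_last_two β (q - 4) (b + q + 2) fun j h3 => hz _ (by omega) (by omega),
      show b + q + 2 + (q - 4) = b + 2 * q - 2 by omega,
      show b + 2 * q - 2 + 1 = b + 2 * q - 1 by omega,
      Odd.neg_one_pow (by obtain ⟨l, hl⟩ := hF.odd; exact ⟨l - 2, by omega⟩)] at h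
    push_cast [Nat.cast_sub (show 4 ≤ q by omega)] at h
    rw [hq0] at h
    linear_combination h

/-- Passing from a level which starts at `a = b + q` to the next one. -/
theorem IsLieSeq.next_level (hF : IsOddCharPower F p q) (H : IsLieSeq β N)
    (S : IsExtraStart β q) {b : ℕ} (hint : ∀ i, b + 2 ≤ i → i < b + q → β i = 0)
    (hN : b + 2 * q + 2 ≤ N) (h0 : β (b + q) ≠ 0) (hlast : β (b + 2 * q - 1) = 0) :
    (∀ i, b + q + 2 ≤ i → i < b + q + q → β i = 0) ∧
    (2 * β (b + q) + 2 * β (b + q + 1) + 1) * β (b + q + q) = β (b + q) := by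
  have h2 := hF.two_ne_zero
  have h5 := hF.five_le
  have h := H.jacobi (b + q - 1) (q - 1) (by omega) (by omega)
  rw [show b + q - 1 + (q - 1) + 2 = b + q + q by omega,
    hint (b + q - 1) (by omega) (by omega), show q - 1 + 2 = 1 + q by omega,
    hF.lieCoeff_add, lieCoeff_one, lieCoeff_one, add_comm 1 q, S.succ,
    hint (b + q - 1) (by omega) (by omega), show b + q - 1 + 1 = b + q by omega,
    show b + q - 1 + q = b + 2 * q - 1 by omega, hlast,
    show b + 2 * q - 1 + 1 = b + q + q by omega] at h
  -- This has to precede the evaluation of the difference on the left: that evaluation uses the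
  -- vanishing of the interior, which is deduced from `hne`.
  have hne : β (b + q + q) ≠ 0 := by
    intro h'
    rw [h'] at h
    apply h0
    field_simp at h
    linear_combination -h
  have hz : ∀ i, b + q + 2 ≤ i → i < b + q + q → β i = 0 := by
    intro i h1 h3
    rcases Nat.lt_or_ge (i + 1) (b + q + q) with h4 | h4
    · exact H.eq_zero_of_ne_zero hF S hint (by omega) hne (by omega) i h1 (by omega)
    · rwa [show i = b + 2 * q - 1 by omega]
  refine ⟨hz, ?_⟩
  rw [hF.lieCoeff_pred β (b + q - 1) (b + q) (b + q + 1) (by omega) (by omega) (by omega)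
        fun i h1 h3 h4 h6 => (Nat.lt_or_ge i (b + q)).elim
          (fun h => hint i (by omega) h) (fun h => hz i (by omega) (by omega))] at h
  field_simp at h
  linear_combination h

/-- The relation between the second nonzero coefficients of two consecutive levels. -/
theorem IsLieSeq.snd_relation (hF : IsOddCharPower F p q) (H : IsLieSeq β N)
    (S : IsExtraStart β q) {a : ℕ} (ha : 1 ≤ a)
    (hint : ∀ i, a + 2 ≤ i → i < a + q → β i = 0)
    (hN : a + q + 3 ≤ N) :
    (2 * β (a + 1) + 1) * β (a + q + 1) = β (a + 1) * (1 - 2 * β (a + q)) := by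
  have h5 := hF.five_le
  have hq0 := hF.cast_eq_zero
  -- The partner is e_q because β_q = 1 keeps the difference of order q at a + 1, that is, β_{a+1} -
  -- β_{a+q+1}.
  have h := H.jacobi (a + 1) (q - 2) (by omega) (by omega)
  rw [show a + 1 + (q - 2) + 2 = a + q + 1 by omega, show q - 2 + 2 = 0 + q by omega,
    hF.lieCoeff_add, lieCoeff_zero, lieCoeff_zero, zero_add, S.one,
    lieCoeff_eq_head β (q - 2) (a + 1) fun j h1 h3 => hint _ (by omega) (by omega),
    show q - 2 = q - 3 + 1 by omega,
    lieCoeff_eq_last_two β (q - 3) (a + 1 + 2) fun j h3 => hint _ (by omega) (by omega),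
    show a + 1 + 2 + (q - 3) = a + q by omega, show a + 1 + q = a + q + 1 by omega,
    Even.neg_one_pow (by obtain ⟨l, hl⟩ := hF.odd; exact ⟨l - 1, by omega⟩)] at h
  push_cast [Nat.cast_sub (show 3 ≤ q by omega)] at h
  rw [hq0] at h
  linear_combination h

end Levels

/-! ### The standard coefficients and their extension over a level -/

section Standard

variable {F : Type u} [Field F] {p q : ℕ} {β : ℕ → F} {N : ℕ}

/-- Let B be the last coefficient. If B ≠ 0, the first and third equations of
`IsLieSeq.last_equations` give 6B = 0, hence 3 = 0 in F, and then the second reads 2 = 0. -/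
theorem IsLieSeq.last_eq_zero_of_half (hF : IsOddCharPower F p q) (H : IsLieSeq β N)
    (S : IsExtraStart β q) {b : ℕ} (hint : ∀ i, b + 2 ≤ i → i < b + q → β i = 0)
    (hN : b + 2 * q + 1 ≤ N) (hA : β (b + q) = 1 / 2) : β (b + 2 * q - 1) = 0 := by
  have h2 := hF.two_ne_zero
  by_contra hB
  obtain ⟨e1, e2, e3⟩ := H.last_equations hF S hint hN hB
  rw [hA] at e1 e2 e3
  have h3 : (3 : F) = 0 := by
    refine mul_right_cancel₀ hB ?_
    field_simp at e1 e3
    refine mul_left_cancel₀ h2 ?_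
    linear_combination 3 * e1 - e3
  field_simp at e2
  apply h2
  linear_combination e2 - β (b + q + 1) * h3

/-- The second of the three equations gives β_{b+q+1} = 1, and the other two then give three times
the last coefficient equal to 0. The ratio -2 is the one that occurs in the chain issuing from -1/4.
-/
theorem IsLieSeq.last_eq_zero_of_ratio (hF : IsOddCharPower F p q) (h3 : (3 : F) ≠ 0)
    (H : IsLieSeq β N)
    (S : IsExtraStart β q) {b : ℕ} (hint : ∀ i, b + 2 ≤ i → i < b + q → β i = 0)
    (hN : b + 2 * q + 1 ≤ N) (hG : β (b + q) = -(2 * β (b + q + 1))) :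
    β (b + 2 * q - 1) = 0 := by
  by_contra hB
  obtain ⟨e1, e2, e3⟩ := H.last_equations hF S hint hN hB
  rw [hG] at e1 e2 e3
  have hG1 : β (b + q + 1) = 1 := by linear_combination -e2
  rw [hG1] at e1 e3
  have : 3 * β (b + 2 * q - 1) = 0 := by linear_combination -e3 - 6 * e1
  simp [h3, hB] at this

/-- A fourth equation, Jacobi for e_{b-2}, e_{2q+1}, e_2, combined with the first one of
`IsLieSeq.last_equations`, gives (β_b + β_{b+1}) β_{b+2q-1} = 0. -/
theorem IsLieSeq.last_eq_zero_of_sum_ne_zero (hF : IsOddCharPower F p q)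
    (H : IsLieSeq β N)
    (S : IsExtraStart β q) {b : ℕ} (hprev : ∀ i, b + 2 ≤ i + q → i < b → β i = 0)
    (hqb : q ≤ b)
    (hint : ∀ i, b + 2 ≤ i → i < b + q → β i = 0)
    (h2q : β (2 * q + 1) = -(1 / 2))
    (hN : b + 2 * q + 1 ≤ N) (hsum : β b + β (b + 1) ≠ 0) :
    β (b + 2 * q - 1) = 0 := by
  have h2 := hF.two_ne_zero
  have h5 := hF.five_le
  by_contra hB
  obtain ⟨e1, -, -⟩ := H.last_equations hF S hint hN hB
  have hz : ∀ i, b + q + 2 ≤ i → i + 2 < b + 2 * q → β i = 0 := fun i h1 h3 =>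
    H.eq_zero_of_ne_zero hF S hint (by omega) hB (by omega) i h1 (by omega)
  have h := H.jacobi (b - 2) (2 * q - 1) (by omega) (by omega)
  rw [show b - 2 + (2 * q - 1) + 2 = b + 2 * q - 1 by omega,
    hprev (b - 2) (by omega) (by omega), show 2 * q - 1 + 2 = 2 * q + 1 by omega, h2q,
    show 2 * q + 1 = 1 + q + q by omega, show 2 * q - 1 = q - 1 + q by omega,
    hF.lieCoeff_add β (q - 1), hF.lieCoeff_add β (1 + q), hF.lieCoeff_add β 1,
    hF.lieCoeff_add β 1, lieCoeff_one, lieCoeff_one, lieCoeff_one,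
    hF.lieCoeff_pred β (b - 2) b (b + 1) (by omega) (by omega) (by omega)
        fun i h1 h3 h4 h6 => (Nat.lt_or_ge i b).elim
          (fun h => hprev i (by omega) h) (fun h => hint i (by omega) (by omega)),
    hF.lieCoeff_pred β (b - 2 + q) (b + q) (b + q + 1) (by omega) (by omega) (by omega)
        fun i h1 h3 h4 h6 => (Nat.lt_or_ge i (b + q)).elim
          (fun h => hint i (by omega) h) (fun h => hz i (by omega) (by omega)),
    hprev (b - 2) (by omega) (by omega), hprev (b - 2 + 1) (by omega) (by omega),
    hint (b - 2 + q) (by omega) (by omega), hint (b - 2 + q + 1) (by omega) (by omega),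
    show b - 2 + q + q = b + 2 * q - 2 by omega,
    show b + 2 * q - 2 + 1 = b + 2 * q - 1 by omega] at h
  have : (β b + β (b + 1)) * β (b + 2 * q - 1) = 0 := by
    field_simp at h
    refine mul_left_cancel₀ h2 ?_
    linear_combination h + e1
  simp [hsum, hB] at this

theorem extraCoeff_self (q : ℕ) : extraCoeff F q q = 1 := by simp [extraCoeff]

theorem extraCoeff_mul {q i : ℕ} (hq : 0 < q) (hi : 2 ≤ i) : extraCoeff F q (i * q) = 1 / 2 := by
  have : i * q ≠ q := by nlinarith
  simp [extraCoeff, this]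

theorem extraCoeff_mul_add_one {q i : ℕ} (hq : 1 < q) (hi : 1 ≤ i) :
    extraCoeff F q (i * q + 1) = -(1 / 2) := by
  have : i * q + 1 ≠ q := by nlinarith
  simp [extraCoeff, this, Nat.add_mod, Nat.mod_eq_of_lt hq]

theorem extraCoeff_eq_zero {q i k : ℕ} (h1 : i * q + 2 ≤ k) (h2 : k < i * q + q) :
    extraCoeff F q k = 0 := by
  obtain ⟨k, rfl⟩ : ∃ l, k = i * q + l := ⟨k - i * q, by omega⟩
  have hk : k % q = k := Nat.mod_eq_of_lt (by omega)
  have hne : i * q + k ≠ q := by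
    rintro h
    have := congrArg (· % q) h
    simp [Nat.add_mod, hk] at this
    omega
  simp [extraCoeff, hne, Nat.add_mod, hk, show k ≠ 0 by omega, show k ≠ 1 by omega]

/-- The coefficients up to `β_M` are those of `extraAlgebra`. -/
def IsExtraUpTo (β : ℕ → F) (q M : ℕ) : Prop :=
  β 2 = 0 ∧ ∀ k, 3 ≤ k → k ≤ M → β k = extraCoeff F q k

theorem IsExtraUpTo.mono {M M' : ℕ} (h : IsExtraUpTo β q M) (hM : M' ≤ M) :
    IsExtraUpTo β q M' := ⟨h.1, fun k h3 hk => h.2 k h3 (hk.trans hM)⟩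

theorem IsExtraUpTo.gap {M : ℕ} (h : IsExtraUpTo β q M) (i : ℕ) (hM : i * q + q ≤ M + 1) :
    ∀ k, i * q + 2 ≤ k → k < i * q + q → β k = 0 := by
  intro k h1 h2
  rcases Nat.lt_or_ge k 3 with h3 | h3
  · rw [show k = 2 by omega, h.1]
  · rw [h.2 k h3 (by omega), extraCoeff_eq_zero h1 h2]

theorem IsExtraUpTo.low {M : ℕ} (h : IsExtraUpTo β q M) (hM : q ≤ M + 1) :
    ∀ k, 2 ≤ k → k < q → β k = 0 := by
  simpa using h.gap 0 (by simpa using hM)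

theorem IsExtraUpTo.isExtraStart {M : ℕ} (h : IsExtraUpTo β q M) (hq : 3 < q)
    (hM : 2 * q ≤ M + 1) : IsExtraStart β q where
  low := h.low (by omega)
  one := by rw [h.2 q (by omega) (by omega), extraCoeff_self]
  succ := by
    have := extraCoeff_mul_add_one (F := F) (q := q) (i := 1) (by omega) le_rfl
    rw [one_mul] at this
    rw [h.2 _ (by omega) (by omega), this]
  gap := by simpa [two_mul] using h.gap 1 (by simpa [two_mul] using hM)

theorem IsExtraUpTo.value {M i : ℕ} (h : IsExtraUpTo β q M) (hq : 3 < q) (hi : 2 ≤ i)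
    (hM : i * q ≤ M) : β (i * q) = 1 / 2 := by
  rw [h.2 _ (by nlinarith) hM, extraCoeff_mul (by omega) hi]

theorem IsExtraUpTo.value_add_one {M i : ℕ} (h : IsExtraUpTo β q M) (hq : 3 < q) (hi : 1 ≤ i)
    (hM : i * q + 1 ≤ M) : β (i * q + 1) = -(1 / 2) := by
  rw [h.2 _ (by nlinarith) hM, extraCoeff_mul_add_one (by omega) hi]

theorem IsExtraUpTo.succ {M : ℕ} (h : IsExtraUpTo β q M)
    (hM : β (M + 1) = extraCoeff F q (M + 1)) : IsExtraUpTo β q (M + 1) := by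
  refine ⟨h.1, fun k h3 hk => ?_⟩
  rcases Nat.lt_or_ge M k with hk' | hk'
  · rwa [show k = M + 1 by omega]
  · exact h.2 k h3 hk'

theorem IsExtraUpTo.level {i : ℕ} (h : IsExtraUpTo β q (i * q + 1)) (hq : 3 < q) (hi : 1 ≤ i)
    (hint : ∀ k, i * q + 2 ≤ k → k < i * q + q → β k = 0)
    (hend : β (i * q + q) = 1 / 2) : IsExtraUpTo β q (i * q + q) := by
  refine ⟨h.1, fun k h3 hk => ?_⟩
  rcases Nat.lt_or_ge (i * q + 1) k with h1 | h1
  · rcases Nat.lt_or_ge k (i * q + q) with h2 | h2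
    · rw [hint k h1 h2, extraCoeff_eq_zero h1 h2]
    · obtain rfl : k = i * q + q := by omega
      rw [hend, show i * q + q = (i + 1) * q by ring, extraCoeff_mul (by omega) (by omega)]
  · exact h.2 k h3 h1

/-- A level which starts with the coefficient `1/2` has vanishing interior. -/
theorem IsLieSeq.half_level (hF : IsOddCharPower F p q) (H : IsLieSeq β N) {i : ℕ} (hi : 2 ≤ i)
    (hN : i * q + q + 2 ≤ N) (h : IsExtraUpTo β q (i * q)) :
    (∀ k, i * q + 2 ≤ k → k < i * q + q → β k = 0) ∧
    (2 + 2 * β (i * q + 1)) * β (i * q + q) = 1 / 2 := by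
  have h2 := hF.two_ne_zero
  have h5 := hF.five_le
  obtain ⟨i, rfl⟩ : ∃ j, i = j + 1 := ⟨i - 1, by omega⟩
  have hv := h.value hF.three_lt hi le_rfl
  have hiq : q ≤ i * q := by nlinarith
  have hg := h.gap i (by rw [add_mul]; omega)
  have S := h.isExtraStart hF.three_lt (by rw [add_mul]; omega)
  rw [show (i + 1) * q = i * q + q by ring] at *
  have hl := H.last_eq_zero_of_half hF S hg (by omega) hv
  obtain ⟨h3, h4⟩ := H.next_level hF S hg (by omega) (by rw [hv]; simpa using h2) hl
  refine ⟨h3, ?_⟩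
  rw [hv] at h4
  field_simp at h4 ⊢
  linear_combination h4

theorem IsLieSeq.extend_odd_level (hF : IsOddCharPower F p q) (H : IsLieSeq β N) {n : ℕ}
    (hn : 1 ≤ n) (hN : 2 * n * q + 2 ≤ N) (h : IsExtraUpTo β q ((2 * n - 1) * q + 1)) :
    IsExtraUpTo β q (2 * n * q) := by
  have h2 := hF.two_ne_zero
  have h5 := hF.five_le
  obtain ⟨i, hi⟩ : ∃ i, 2 * n = i + 1 := ⟨2 * n - 1, by omega⟩
  rw [hi, Nat.add_sub_cancel] at h
  rw [hi, add_mul, one_mul] at hN ⊢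
  -- Level 1 is treated apart because it starts with 1 and not with 1/2.
  rcases Nat.lt_or_ge i 2 with hi2 | hi2
  · obtain rfl : i = 1 := by omega
    rw [one_mul] at hN
    have S := H.isExtraStart hF (by omega) (h.low (by omega))
      (by rw [h.2 q (by omega) (by omega), extraCoeff_self])
      (by simpa using h.value_add_one hF.three_lt le_rfl le_rfl)
    refine h.level hF.three_lt le_rfl ?_ ?_
    · simpa [two_mul] using S.gap
    · simpa [two_mul] using H.value_two_mul hF (by omega) S
  · obtain ⟨h3, h4⟩ := H.half_level hF hi2 (by omega) (h.mono (by omega))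
    refine h.level hF.three_lt (by omega) h3 ?_
    rw [h.value_add_one hF.three_lt (by omega) le_rfl] at h4
    field_simp at h4 ⊢
    linear_combination h4

/-- The first consequence of antisymmetry for the coefficients in the levels `2n` and
`2n + 1`. -/
theorem IsLieSeq.antisymm_relation (hF : IsOddCharPower F p q) (H : IsLieSeq β N) {n : ℕ}
    (hn : 1 ≤ n) (hN : 2 * n * q + q + 3 ≤ N) (h : IsExtraUpTo β q (2 * n * q))
    (hint : ∀ k, 2 * n * q + 2 ≤ k → k < 2 * n * q + q → β k = 0) :
    β (2 * n * q + q) + 2 * β (2 * n * q + q + 1) + 1 / 2 =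
      2 * n * (β (2 * n * q + 1) + 1 / 2) := by
  have h5 := hF.five_le
  obtain ⟨i, hi⟩ : ∃ i, n = i + 1 := ⟨n - 1, by omega⟩
  -- One side is a sum over q consecutive indices. The other is a 2n-th difference with step q of
  -- the second coefficients of the levels, which are -1/2 except for the last two.
  have ha := H.antisymm (q + 1) (2 * n * q + 2) (by omega) (by omega) (by omega)
  rw [show q + 1 - 2 = q - 1 by omega, show 2 * n * q + 2 - 2 = 0 + 2 * n * q by omega,
    hF.lieCoeff_mul_add,
    hF.lieCoeff_pred β (2 * n * q + 2) (2 * n * q + q) (2 * n * q + q + 1) (by omega) (by omega)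
      (by omega) fun k h1 h3 h4 h6 => hint k (by omega) (by omega)] at ha
  simp only [lieCoeff_zero] at ha
  rw [show 2 * n = (2 * i + 1) + 1 by omega, lieCoeff_of_const _ (-(1 / 2))] at ha
  · rw [Odd.neg_one_pow ⟨i, rfl⟩,
      show q + 1 + (0 + (2 * i + 1)) * q = (2 * i + 1 + 1) * q + 1 by ring,
      show q + 1 + (0 + (2 * i + 1) + 1) * q = (2 * i + 1 + 1) * q + q + 1 by ring] at ha
    rw [hi, show 2 * (i + 1) = 2 * i + 1 + 1 by ring]
    push_cast at ha ⊢
    linear_combination ha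
  · intro j hj
    rw [show q + 1 + (0 + j) * q = (j + 1) * q + 1 by ring]
    refine h.value_add_one hF.three_lt (by omega) ?_
    have : (j + 2) * q ≤ 2 * n * q := Nat.mul_le_mul_right q (by omega)
    nlinarith

/-- The second consequence of antisymmetry, for the coefficients in the levels `2n`,
`2n + 1` and `2n + 2`. -/
theorem IsLieSeq.antisymm_relation' (hF : IsOddCharPower F p q) (H : IsLieSeq β N) {n : ℕ}
    (hn : 1 ≤ n) (hN : 2 * n * q + 2 * q + 2 ≤ N) (h : IsExtraUpTo β q (2 * n * q))
    (hint : ∀ k, 2 * n * q + 2 ≤ k → k < 2 * n * q + q → β k = 0)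
    (hint' : ∀ k, 2 * n * q + q + 2 ≤ k → k < 2 * n * q + q + q → β k = 0) :
    2 * (β (2 * n * q + q + 1) + β (2 * n * q + q + q)) =
      2 * n * (β (2 * n * q + 1) + β (2 * n * q + q)) := by
  have h5 := hF.five_le
  obtain ⟨i, hi⟩ : ∃ i, n = i + 1 := ⟨n - 1, by omega⟩
  -- Both orders are q - 1 modulo q, so the levels enter only through the sums β_{iq+1} +
  -- β_{(i+1)q}, which are 0 for the levels already known.
  have ha := H.antisymm (q + 1) (2 * n * q + q + 1) (by omega) (by omega) (by omega)
  rw [show q + 1 - 2 = q - 1 by omega, show 2 * n * q + q + 1 - 2 = q - 1 + 2 * n * q by omega,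
    hF.lieCoeff_mul_add,
    hF.lieCoeff_pred β (2 * n * q + q + 1) (2 * n * q + q + 1) (2 * n * q + q + q) (by omega)
      (by omega) (by omega) fun k h1 h3 h4 h6 => hint' k (by omega) (by omega)] at ha
  rw [show 2 * n = (2 * i + 1) + 1 by omega, lieCoeff_of_const _ 0] at ha
  · rw [Odd.neg_one_pow ⟨i, rfl⟩,
      show q + 1 + (0 + (2 * i + 1)) * q = 2 * n * q + 1 by subst hi; ring,
      show q + 1 + (0 + (2 * i + 1) + 1) * q = 2 * n * q + q + 1 by subst hi; ring,
      show (2 * i + 1 + 1) * q = 2 * n * q by subst hi; ring,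
      hF.lieCoeff_pred β (2 * n * q + 1) (2 * n * q + 1) (2 * n * q + q) (by omega)
      (by omega) (by omega) fun k h1 h3 h4 h6 => hint k (by omega) (by omega),
      hF.lieCoeff_pred β (2 * n * q + q + 1) (2 * n * q + q + 1) (2 * n * q + q + q) (by omega)
      (by omega) (by omega) fun k h1 h3 h4 h6 => hint' k (by omega) (by omega)] at ha
    have hc : (2 * n : F) = 2 * i + 1 + 1 := by subst hi; push_cast; ring
    rw [hc]
    push_cast at ha
    linear_combination ha
  · intro j hj
    have hj2 : (j + 2) * q ≤ 2 * n * q := Nat.mul_le_mul_right q (by omega)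
    have e : (j + 2) * q = (j + 1) * q + q := by ring
    rw [show q + 1 + (0 + j) * q = (j + 1) * q + 1 by ring,
      hF.lieCoeff_pred β ((j + 1) * q + 1) ((j + 1) * q + 1) ((j + 2) * q) (by omega)
      (by omega) (by omega)
      fun k h1 h3 h4 h6 => h.gap (j + 1) (by omega) k (by omega) (by omega),
      h.value_add_one hF.three_lt (by omega) (by omega),
      h.value hF.three_lt (by omega) hj2]
    ring

end Standard

/-! ### The equation for β_{2nq+1} and its two roots -/

section Uniqueness

variable {F : Type u} [Field F] {p q : ℕ} {β : ℕ → F} {N : ℕ}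

/-- The relations between the coefficients in the levels `2n` and `2n + 1`. -/
theorem IsLieSeq.level_equations (hF : IsOddCharPower F p q) (H : IsLieSeq β N) {n : ℕ}
    (hn : 1 ≤ n) (hN : 2 * n * q + q + 3 ≤ N) (h : IsExtraUpTo β q (2 * n * q)) :
    (4 + 4 * β (2 * n * q + 1)) * β (2 * n * q + q) = 1 ∧
    (2 * β (2 * n * q + 1) + 1) * β (2 * n * q + q + 1) =
      β (2 * n * q + 1) * (1 - 2 * β (2 * n * q + q)) ∧
    2 * β (2 * n * q + q) + 4 * β (2 * n * q + q + 1) + 1 =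
      2 * n * (2 * β (2 * n * q + 1) + 1) := by
  have h2 := hF.two_ne_zero
  have h5 := hF.five_le
  have hq : q ≤ n * q := Nat.le_mul_of_pos_left q hn
  have e2 : 2 * n * q = n * q + n * q := by ring
  obtain ⟨hint, h4⟩ := H.half_level hF (i := 2 * n) (by omega) (by omega) h
  have S := h.isExtraStart hF.three_lt (by omega)
  have hg := H.snd_relation hF S (by omega) hint (by omega)
  have ha := H.antisymm_relation hF hn hN h hint
  refine ⟨?_, hg, ?_⟩
  · field_simp at h4
    linear_combination h4
  · field_simp at ha
    linear_combination ha

theorem eq_neg_half_or_of_cubic (h2 : (2 : F) ≠ 0) {l : F}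
    (h : 16 * l ^ 3 + 20 * l ^ 2 + 8 * l + 1 = 0) : l = -(1 / 2) ∨ l = -(1 / 4) := by
  have h' : (2 * l + 1) * ((2 * l + 1) * (4 * l + 1)) = 0 := by linear_combination h
  have h4 : (4 : F) ≠ 0 := by
    have : (4 : F) = 2 * 2 := by norm_num
    rw [this]
    exact mul_ne_zero h2 h2
  have aux : 2 * l + 1 = 0 → l = -(1 / 2) := fun h => by
    field_simp
    linear_combination h
  rcases mul_eq_zero.mp h' with h | h
  · exact Or.inl (aux h)
  rcases mul_eq_zero.mp h with h | h
  · exact Or.inl (aux h)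
  · right
    field_simp
    linear_combination h

/-- For n = 1 the three equations of `IsLieSeq.level_equations` suffice: eliminating the first two
coefficients of level 3 leaves (2l + 1)^2 (4l + 1) = 0. -/
theorem IsLieSeq.eq_or_eq_of_first (hF : IsOddCharPower F p q) (H : IsLieSeq β N)
    (hN : 3 * q + 3 ≤ N) (h : IsExtraUpTo β q (2 * q)) :
    β (2 * q + 1) = -(1 / 2) ∨ β (2 * q + 1) = -(1 / 4) := by
  obtain ⟨ea, eg, es⟩ := H.level_equations hF (n := 1) le_rfl (by omega) (by simpa using h)
  simp only [mul_one] at ea eg es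
  push_cast at es
  apply eq_neg_half_or_of_cubic hF.two_ne_zero
  generalize β (2 * q + 1) = l at *
  generalize β (2 * q + q) = a at *
  generalize β (2 * q + q + 1) = g at *
  linear_combination (1 - 2 * l) * ea + 8 * (1 + l) * eg - 2 * (1 + l) * (2 * l + 1) * es

/-- For n ≥ 2 the image of n in F acts as a further unknown. The missing equation involves the start
of level 2n + 2, whence the larger bound on N. If l ≠ -1/2, one may divide by 2l + 1, and
elimination leads to the same cubic. -/
theorem IsLieSeq.eq_or_eq (hF : IsOddCharPower F p q) (H : IsLieSeq β N) {n : ℕ} (hn : 1 ≤ n)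
    (hN : (2 * n + 2) * q + 2 ≤ N) (h : IsExtraUpTo β q (2 * n * q)) :
    β (2 * n * q + 1) = -(1 / 2) ∨ β (2 * n * q + 1) = -(1 / 4) := by
  have h5 := hF.five_le
  have h2 := hF.two_ne_zero
  rcases Nat.lt_or_ge n 2 with hn2 | hn2
  · obtain rfl : n = 1 := by omega
    exact H.eq_or_eq_of_first hF (by omega) (by simpa using h)
  by_cases hl : 2 * β (2 * n * q + 1) + 1 = 0
  · left
    field_simp
    linear_combination hl
  rw [show (2 * n + 2) * q = 2 * n * q + 2 * q by ring] at hN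
  have hq : 2 * q ≤ n * q := Nat.mul_le_mul_right q hn2
  have e2 : 2 * n * q = n * q + n * q := by ring
  have e3 : (2 * n - 1) * q + q = 2 * n * q := by
    rw [← Nat.succ_mul]
    congr 1
    omega
  obtain ⟨ea, eg, es⟩ := H.level_equations hF hn (by omega) h
  obtain ⟨hint, -⟩ := H.half_level hF (i := 2 * n) (by omega) (by omega) h
  have S := h.isExtraStart hF.three_lt (by omega)
  -- Here β_{2nq} + β_{2nq+1} = 1/2 + l is nonzero. That β_{2q+1} = -1/2 is already known needs n ≥
  -- 2.
  have hlast : β (2 * n * q + 2 * q - 1) = 0 := by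
    refine H.last_eq_zero_of_sum_ne_zero hF S
      (fun i h1 h3 => h.gap (2 * n - 1) (by omega) i (by omega) (by omega)) (by omega) hint
      (h.value_add_one hF.three_lt (by omega) (by omega)) (by omega) ?_
    rw [h.value hF.three_lt (by omega) le_rfl]
    contrapose! hl
    field_simp at hl
    linear_combination hl
  have ha0 : β (2 * n * q + q) ≠ 0 := by
    intro h0
    simp [h0] at ea
  obtain ⟨hint', e4⟩ := H.next_level hF S hint (by omega) ha0 hlast
  have e5 := H.antisymm_relation' hF hn (by omega) h hint hint'
  apply eq_neg_half_or_of_cubic h2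
  generalize β (2 * n * q + 1) = l at *
  generalize β (2 * n * q + q) = a at *
  generalize β (2 * n * q + q + 1) = g at *
  generalize β (2 * n * q + q + q) = c at *
  generalize (n : F) = m at *
  have f1 : 2 * (1 + l) * g = l :=
    mul_left_cancel₀ hl (by linear_combination 2 * (1 + l) * eg - l * ea)
  have f2 : 4 * m * (1 + l) = 3 :=
    mul_left_cancel₀ hl (by linear_combination -2 * (1 + l) * es + ea + 4 * f1)
  have f3 : 2 * (4 * l + 3) * c = 1 := by
    linear_combination 4 * (1 + l) * e4 - 4 * c * f1 - 2 * c * ea + ea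
  have f4 : 4 * (1 + l) * c = l + 3 * a := by
    linear_combination 2 * (1 + l) * e5 + (l + a) * f2 - 2 * f1
  linear_combination 8 * (1 + l) ^ 2 * f3 - (4 * l + 3) * (4 * (1 + l)) * f4
    - 3 * (4 * l + 3) * ea

/-- The chain of coefficients that starts with `-1/4`. -/
theorem IsLieSeq.quarter_chain (hF : IsOddCharPower F p q) (H : IsLieSeq β N) {m : ℕ}
    (h : IsExtraUpTo β q ((2 * m + 2) * q)) (hl : β ((2 * m + 2) * q + 1) = -(1 / 4)) (j : ℕ)
    (hj : j + 2 < p) (hN : (2 * m + 2 + j) * q + 3 ≤ N) :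
    (∀ k, (2 * m + 1 + j) * q + 2 ≤ k → k < (2 * m + 1 + j) * q + q → β k = 0) ∧
    (j + 2) * β ((2 * m + 2 + j) * q) = 1 ∧ 2 * (j + 2) * β ((2 * m + 2 + j) * q + 1) = -1 := by
  have h5 := hF.five_le
  have h2 := hF.two_ne_zero
  have := hF.char
  have h4 : (4 : F) ≠ 0 := by
    have : (4 : F) = 2 * 2 := by norm_num
    rw [this]
    exact mul_ne_zero h2 h2
  have e0 : (2 * m + 2) * q = (2 * m + 1) * q + q := by ring
  have e1 : (2 * m + 2) * q = 2 * (m * q) + 2 * q := by ring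
  induction j with
  | zero =>
    refine ⟨fun k h1 h3 => h.gap (2 * m + 1) (by omega) k (by simpa using h1) (by simpa using h3),
      ?_, ?_⟩
    · simp only [add_zero]
      rw [h.value hF.three_lt (by omega) le_rfl]
      field_simp
      simp
    · simp only [add_zero]
      rw [hl]
      field_simp
      push_cast
      ring
  | succ j ih =>
    have eN : (2 * m + 2 + (j + 1)) * q = (2 * m + 1 + j) * q + q + q := by ring
    obtain ⟨hint, hA, hG⟩ := ih (by omega) (by
      rw [show (2 * m + 2 + j) * q = (2 * m + 1 + j) * q + q by ring]; omega)
    rw [show (2 * m + 2 + j) * q = (2 * m + 1 + j) * q + q by ring] at hA hG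
    rw [eN] at hN ⊢
    rw [show (2 * m + 1 + (j + 1)) * q = (2 * m + 1 + j) * q + q by ring]
    have S := h.isExtraStart hF.three_lt (by omega)
    have hA0 : β ((2 * m + 1 + j) * q + q) ≠ 0 := by
      intro h0
      simp [h0] at hA
    have hR : (j + 2 : F) ≠ 0 := by
      intro h0
      simp [h0] at hA
    have hlast : β ((2 * m + 1 + j) * q + 2 * q - 1) = 0 := by
      rcases Nat.eq_zero_or_pos j with rfl | hj0
      · refine H.last_eq_zero_of_half hF S hint (by omega) ?_
        push_cast at hA
        field_simp
        linear_combination hA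
      · refine H.last_eq_zero_of_ratio hF ?_ S hint (by omega) ?_
        · intro h3
          have h3' : ((3 : ℕ) : F) = 0 := by exact_mod_cast h3
          rw [CharP.cast_eq_zero_iff F p] at h3'
          have := Nat.le_of_dvd (by norm_num) h3'
          omega
        · exact mul_left_cancel₀ hR (by linear_combination hA + hG)
    obtain ⟨hint', e4⟩ := H.next_level hF S hint (by omega) hA0 hlast
    have eg := H.snd_relation hF S (a := (2 * m + 1 + j) * q + q) (by omega) hint' (by omega)
    have hR1 : (j + 1 : F) ≠ 0 := by
      have : ((j + 1 : ℕ) : F) ≠ 0 := by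
        rw [Ne, CharP.cast_eq_zero_iff F p]
        intro hd
        have := Nat.le_of_dvd (by omega) hd
        omega
      exact_mod_cast this
    push_cast
    generalize β ((2 * m + 1 + j) * q + q) = a at *
    generalize β ((2 * m + 1 + j) * q + q + 1) = g at *
    generalize β ((2 * m + 1 + j) * q + q + q) = a' at *
    generalize β ((2 * m + 1 + j) * q + q + q + 1) = g' at *
    -- Since g = -a/2, the relation between the levels is (a + 1) a' = a, so a = 1/(j + 2) gives a'
    -- = 1/(j + 3). The value of g' then follows from `eg` after cancelling j + 1, a unit since j +
    -- 1 < p.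
    have f1 : (j + 1 + 2) * a' = 1 := by
      linear_combination (j + 2 : F) * e4 - (2 * a' - 1) * hA - a' * hG
    refine ⟨hint', f1, mul_left_cancel₀ hR1 ?_⟩
    linear_combination 2 * (j + 3 : F) * (j + 2) * eg
      + (-2 * (j + 3) * g' + (j + 3 : F) * (1 - 2 * a')) * hG + 2 * f1

/-- In the chain, level 2n + j starts with 1/(j + 2). At j = p - 2 the relation would read p β = 1,
so the equations cannot hold as far as that weight. -/
theorem IsLieSeq.lt_of_eq_neg_quarter (hF : IsOddCharPower F p q) (H : IsLieSeq β N) {n : ℕ}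
    (hn : 1 ≤ n) (h : IsExtraUpTo β q (2 * n * q)) (hl : β (2 * n * q + 1) = -(1 / 4)) :
    N < (2 * n + p - 2) * q + 2 := by
  have h5 := hF.five_le
  have := hF.char
  by_contra! hN
  obtain ⟨m, rfl⟩ : ∃ m, n = m + 1 := ⟨n - 1, by omega⟩
  obtain ⟨j, rfl⟩ : ∃ j, p = j + 3 := by
    have := hF.prime.two_le
    have := hF.ne_two
    exact ⟨p - 3, by omega⟩
  rw [show 2 * (m + 1) = 2 * m + 2 by ring] at h hl hN
  have eN : (2 * m + 2 + (j + 3) - 2) * q = (2 * m + 1 + j) * q + q + q := by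
    rw [show 2 * m + 2 + (j + 3) - 2 = 2 * m + 1 + j + 1 + 1 by omega]
    ring
  have e1 : (2 * m + 2) * q = 2 * (m * q) + 2 * q := by ring
  rw [eN] at hN
  obtain ⟨hint, hA, hG⟩ := H.quarter_chain hF h hl j (by omega) (by
      rw [show (2 * m + 2 + j) * q = (2 * m + 1 + j) * q + q by ring]; omega)
  rw [show (2 * m + 2 + j) * q = (2 * m + 1 + j) * q + q by ring] at hA hG
  have S := h.isExtraStart hF.three_lt (by omega)
  have hA0 : β ((2 * m + 1 + j) * q + q) ≠ 0 := by
    intro h0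
    simp [h0] at hA
  have hR : (j + 2 : F) ≠ 0 := by
    intro h0
    simp [h0] at hA
  have hp : (j + 3 : F) = 0 := by exact_mod_cast CharP.cast_eq_zero F (j + 3)
  have hlast : β ((2 * m + 1 + j) * q + 2 * q - 1) = 0 := by
    -- The case j = 0 is p = 3, where the argument by the ratio is not available; the level then
    -- starts with 1/2.
    rcases Nat.eq_zero_or_pos j with rfl | hj0
    · refine H.last_eq_zero_of_half hF S hint (by omega) ?_
      have h2 := hF.two_ne_zero
      push_cast at hA
      field_simp
      linear_combination hA
    · refine H.last_eq_zero_of_ratio hF ?_ S hint (by omega) ?_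
      · intro h3
        have h3' : ((3 : ℕ) : F) = 0 := by exact_mod_cast h3
        rw [CharP.cast_eq_zero_iff F (j + 3)] at h3'
        have := Nat.le_of_dvd (by norm_num) h3'
        omega
      · exact mul_left_cancel₀ hR (by linear_combination hA + hG)
  obtain ⟨-, e4⟩ := H.next_level hF S hint (by omega) hA0 hlast
  generalize β ((2 * m + 1 + j) * q + q) = a at *
  generalize β ((2 * m + 1 + j) * q + q + 1) = g at *
  generalize β ((2 * m + 1 + j) * q + q + q) = a' at *
  have f1 : (j + 3) * a' = 1 := by
    linear_combination (j + 2 : F) * e4 - (2 * a' - 1) * hA - a' * hG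
  simp [hp] at f1

/-- In the infinite-dimensional case all coefficients are determined. -/
theorem isExtraUpTo_of_forall_isLieSeq (hF : IsOddCharPower F p q) (H : ∀ N, IsLieSeq β N)
    (low : ∀ i, 3 ≤ i → i < q → β i = 0) (one : β q = 1) (M : ℕ) : IsExtraUpTo β q M := by
  have h5 := hF.five_le
  have h2 := hF.two_ne_zero
  have hall : ∀ n, IsExtraUpTo β q ((2 * n + 1) * q + 1) := by
    intro n
    induction n with
    | zero =>
      have low' : ∀ i, 2 ≤ i → i < q → β i = 0 := by
        intro i h1 h3
        rcases Nat.lt_or_ge i 3 with h4 | h4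
        · rw [show i = 2 by omega, (H 0).two]
        · exact low i h4 h3
      have hs := (H (q + 3)).value_succ hF le_rfl low' one
      refine ⟨(H 0).two, fun k h3 hk => ?_⟩
      simp only [mul_zero, zero_add, one_mul] at hk
      rcases Nat.lt_trichotomy k q with h | rfl | h
      · rw [low k h3 h, extraCoeff_eq_zero (i := 0) (by omega) (by omega)]
      · rw [one, extraCoeff_self]
      · obtain rfl : k = q + 1 := by omega
        have := extraCoeff_mul_add_one (F := F) (q := q) (i := 1) (by omega) le_rfl
        rw [one_mul] at this
        rw [hs, this]
    | succ n ih =>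
      have h1 := (H _).extend_odd_level hF (n := n + 1) (by omega) le_rfl
        (by rwa [show 2 * (n + 1) - 1 = 2 * n + 1 by omega])
      have hl : β (2 * (n + 1) * q + 1) = -(1 / 2) := by
        rcases (H _).eq_or_eq hF (by omega) le_rfl h1 with h | h
        · exact h
        -- With N equal to the bound in the lemma itself, its conclusion is N < N.
        · exact ((H _).lt_of_eq_neg_quarter hF (by omega) h1 h |>.false).elim
      obtain ⟨hint, he⟩ := (H _).half_level hF (i := 2 * (n + 1)) (by omega) le_rfl h1
      have hA : β (2 * (n + 1) * q + q) = 1 / 2 := by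
        rw [hl] at he
        field_simp at he ⊢
        linear_combination he
      -- At l = -1/2 and first coefficient 1/2 the relation `IsLieSeq.snd_relation` degenerates to 0
      -- = 0, so the second coefficient of the next level has to come from anticommutativity.
      have ha := (H _).antisymm_relation hF (n := n + 1) (by omega) le_rfl h1 hint
      have h3 := (h1.succ (by rw [hl, extraCoeff_mul_add_one (by omega) (by omega)])).level
        hF.three_lt (by omega) hint hA
      rw [show 2 * (n + 1) * q + q = (2 * (n + 1) + 1) * q by ring] at h3 ha hA
      refine h3.succ ?_
      rw [extraCoeff_mul_add_one (by omega) (by omega)]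
      rw [hl, hA] at ha
      field_simp at ha ⊢
      exact mul_left_cancel₀ h2 (by linear_combination ha)
  refine (hall M).mono ?_
  nlinarith

end Uniqueness

/-! ### The standard sequence in a Lie algebra and the presentation -/

section StdSeq

variable {F : Type u} [Field F] {L : Type v} [LieRing L] [LieAlgebra F L] {x y : L}

@[simp] theorem stdSeq_zero : stdSeq x y 0 = 0 := rfl
@[simp] theorem stdSeq_one : stdSeq x y 1 = x := rfl
@[simp] theorem stdSeq_two : stdSeq x y 2 = y := rfl

theorem stdSeq_lie_fst {k : ℕ} (hk : 2 ≤ k) : ⁅stdSeq x y k, x⁆ = stdSeq x y (k + 1) := by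
  obtain ⟨k, rfl⟩ : ∃ l, k = l + 2 := ⟨k - 2, by omega⟩
  rfl

theorem stdSeq_ne_zero_of_le {k N : ℕ} (hk : 2 ≤ k) (hkN : k ≤ N) (hN : stdSeq x y N ≠ 0) :
    stdSeq x y k ≠ 0 := by
  induction N, hkN using Nat.le_induction with
  | base => exact hN
  | succ N hN' ih =>
    apply ih
    intro h
    apply hN
    rw [← stdSeq_lie_fst (hk.trans hN'), h, zero_lie]

theorem stdSeq_smul_snd (c : F) {k : ℕ} (hk : 2 ≤ k) :
    stdSeq x (c • y) k = c • stdSeq x y k := by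
  induction k, hk using Nat.le_induction with
  | base => rfl
  | succ k hk ih => rw [← stdSeq_lie_fst hk, ih, smul_lie, stdSeq_lie_fst hk]

theorem map_stdSeq {L' : Type*} [LieRing L'] [LieAlgebra F L'] (f : L →ₗ⁅F⁆ L') (k : ℕ) :
    f (stdSeq x y k) = stdSeq (f x) (f y) k := by
  rcases Nat.lt_or_ge k 2 with h | h
  · interval_cases k <;> simp
  · induction k, h using Nat.le_induction with
    | base => rfl
    | succ k hk ih => rw [← stdSeq_lie_fst hk, LieHom.map_lie, ih, stdSeq_lie_fst hk]

/-- As e_{k+3} = [e_{k+2}, e_1] and bracketing with e_1 is a derivation, each step of the second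
index costs one difference in the first. -/
theorem stdSeq_lie_stdSeq {β : ℕ → F}
    (hβ : ∀ k, 2 ≤ k → ⁅stdSeq x y k, y⁆ = β k • stdSeq x y (k + 2)) {m : ℕ} (hm : 2 ≤ m)
    (k : ℕ) :
    ⁅stdSeq x y m, stdSeq x y (k + 2)⁆ = lieCoeff β k m • stdSeq x y (m + k + 2) := by
  induction k generalizing m with
  | zero => exact hβ m hm
  | succ k ih =>
    rw [show k + 1 + 2 = (k + 2) + 1 by ring, ← stdSeq_lie_fst (by omega : 2 ≤ k + 2),
      leibniz_lie, ih hm, smul_lie, stdSeq_lie_fst (by omega), stdSeq_lie_fst hm,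
      ← lie_skew, ih (by omega), lieCoeff_succ, sub_smul,
      show m + 1 + k + 2 = m + k + 2 + 1 by ring, show m + (k + 1) + 2 = m + k + 2 + 1 by ring]
    abel

/-- If e_N ≠ 0, then all e_k with 2 ≤ k ≤ N are nonzero, so scalars can be compared in every
identity of weight at most N. -/
theorem isLieSeq_of_stdSeq_ne_zero {β : ℕ → F} (hβ2 : β 2 = 0)
    (hβ : ∀ k, 2 ≤ k → ⁅stdSeq x y k, y⁆ = β k • stdSeq x y (k + 2)) {N : ℕ}
    (hN : stdSeq x y N ≠ 0) : IsLieSeq β N where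
  two := hβ2
  antisymm m n hm hn hmn := by
    obtain ⟨m, rfl⟩ : ∃ l, m = l + 2 := ⟨m - 2, by omega⟩
    obtain ⟨n, rfl⟩ : ∃ l, n = l + 2 := ⟨n - 2, by omega⟩
    have h1 := stdSeq_lie_stdSeq hβ hm n
    have h2 := stdSeq_lie_stdSeq hβ hn m
    rw [← lie_skew, h2, ← neg_smul, show n + 2 + m + 2 = m + 2 + n + 2 by ring] at h1
    exact (smul_left_injective F (stdSeq_ne_zero_of_le (by omega) (by omega) hN) h1).symm
  jacobi m k hm hmk := by
    have h1 := stdSeq_lie_stdSeq hβ hm k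
    have h2 : ⁅⁅stdSeq x y m, stdSeq x y (k + 2)⁆, y⁆ =
        (lieCoeff β k m * β (m + k + 2)) • stdSeq x y (m + k + 4) := by
      rw [h1, smul_lie, hβ _ (by omega), smul_smul]
    rw [lie_lie, hβ m hm, hβ (k + 2) (by omega), lie_smul, stdSeq_lie_stdSeq hβ hm (k + 2),
      ← lie_skew, smul_lie, stdSeq_lie_stdSeq hβ (by omega) k, sub_neg_eq_add, smul_smul,
      smul_smul, show m + (k + 2) + 2 = m + k + 4 by ring,
      show m + 2 + k + 2 = m + k + 4 by ring, ← add_smul] at h2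
    have := smul_left_injective F (stdSeq_ne_zero_of_le (by omega) (by omega) hN) h2
    linear_combination -this

theorem stdSeq_lie_snd_eq_extension {β : ℕ → F}
    (hβ : ∀ k, 3 ≤ k → ⁅stdSeq x y k, y⁆ = β k • stdSeq x y (k + 2)) :
    ∀ k, 2 ≤ k → ⁅stdSeq x y k, y⁆ = (if k = 2 then 0 else β k) • stdSeq x y (k + 2) := by
  intro k hk
  split_ifs with h
  · subst h; simp
  · exact hβ k (by omega)

/-- The brackets of two elements of the standard sequence are multiples of the elements of the
standard sequence. -/
theorem stdSeq_lie_mem_span {β : ℕ → F}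
    (hβ : ∀ k, 3 ≤ k → ⁅stdSeq x y k, y⁆ = β k • stdSeq x y (k + 2)) (m n : ℕ) :
    ⁅stdSeq x y m, stdSeq x y n⁆ ∈ Submodule.span F {stdSeq x y (m + n)} := by
  wlog hmn : n ≤ m generalizing m n
  · rw [← lie_skew, add_comm]
    exact neg_mem (this n m (by omega))
  rcases Nat.lt_or_ge m 2 with hm | hm
  · interval_cases m <;> interval_cases n <;> simp
  · rcases Nat.lt_or_ge n 2 with hn | hn
    · interval_cases n
      · simp
      · rw [stdSeq_one, stdSeq_lie_fst hm]
        exact Submodule.mem_span_singleton_self _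
    · obtain ⟨n, rfl⟩ : ∃ l, n = l + 2 := ⟨n - 2, by omega⟩
      rw [stdSeq_lie_stdSeq (stdSeq_lie_snd_eq_extension hβ) hm n, ← add_assoc]
      exact Submodule.smul_mem _ _ (Submodule.mem_span_singleton_self _)

/-- If `L` is generated by `x` and `y`, then `L` is spanned by the standard sequence. -/
theorem span_stdSeq_eq_top {β : ℕ → F} (hgen : LieSubalgebra.lieSpan F L {x, y} = ⊤)
    (hβ : ∀ k, 3 ≤ k → ⁅stdSeq x y k, y⁆ = β k • stdSeq x y (k + 2)) :
    Submodule.span F (Set.range fun n => stdSeq x y (n + 1)) = ⊤ := by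
  set W := Submodule.span F (Set.range fun n => stdSeq x y (n + 1)) with hW
  have hmem : ∀ n, stdSeq x y n ∈ W := by
    intro n
    rcases n with _ | n
    · simp
    · exact Submodule.subset_span ⟨n, rfl⟩
  let A : LieSubalgebra F L :=
    { W with
      lie_mem' := by
        intro a b ha hb
        change ⁅a, b⁆ ∈ W
        change a ∈ W at ha
        change b ∈ W at hb
        rw [hW] at ha
        induction ha using Submodule.span_induction with
        | mem a ha =>
          obtain ⟨m, rfl⟩ := ha
          rw [hW] at hb
          induction hb using Submodule.span_induction with
          | mem b hb =>
            obtain ⟨n, rfl⟩ := hb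
            exact (Submodule.span_singleton_le_iff_mem _ _).mpr (hmem _)
              (stdSeq_lie_mem_span hβ _ _)
          | zero => simp
          | add b c _ _ h1 h2 => rw [lie_add]; exact add_mem h1 h2
          | smul c b _ h1 => rw [lie_smul]; exact Submodule.smul_mem _ _ h1
        | zero => simp
        | add a c _ _ h1 h2 => rw [add_lie]; exact add_mem h1 h2
        | smul c a _ h1 => rw [smul_lie]; exact Submodule.smul_mem _ _ h1 }
  have hA : LieSubalgebra.lieSpan F L {x, y} ≤ A := by
    rw [LieSubalgebra.lieSpan_le]
    rintro z (rfl | rfl)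
    · exact hmem 1
    · exact hmem 2
  rw [hgen] at hA
  exact eq_top_iff.mpr fun z _ => hA (LieSubalgebra.mem_top z)

/-- A Lie algebra generated by `x` and `y` with the relations `[e_k, y] = β_k e_{k+2}`, in which
the elements `e_k` are linearly independent, is presented by these relations. -/
theorem existsUnique_lieHom {β : ℕ → F} (hgen : LieSubalgebra.lieSpan F L {x, y} = ⊤)
    (hβ : ∀ k, 3 ≤ k → ⁅stdSeq x y k, y⁆ = β k • stdSeq x y (k + 2))
    (hli : LinearIndependent F fun n => stdSeq x y (n + 1))
    {K : Type*} [LieRing K] [LieAlgebra F K] {x' y' : K}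
    (hβ' : ∀ k, 3 ≤ k → ⁅stdSeq x' y' k, y'⁆ = β k • stdSeq x' y' (k + 2)) :
    ∃! ψ : L →ₗ⁅F⁆ K, ψ x = x' ∧ ψ y = y' := by
  let b := Module.Basis.mk hli (span_stdSeq_eq_top hgen hβ).ge
  have hb : ∀ n, b n = stdSeq x y (n + 1) := fun n => Module.Basis.mk_apply _ _ n
  let f : L →ₗ[F] K := b.constr F fun n => stdSeq x' y' (n + 1)
  have hf : ∀ n, f (stdSeq x y n) = stdSeq x' y' n := by
    intro n
    rcases n with _ | n
    · simp
    · rw [← hb, Module.Basis.constr_basis]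
  have hx : f x = x' := hf 1
  have hy : f y = y' := hf 2
  -- By the Jacobi identity the z that satisfy this for all w form a subalgebra, so the generators x
  -- and y suffice.
  have key : ∀ z : L, ∀ w, f ⁅w, z⁆ = ⁅f w, f z⁆ := by
    intro z
    have hz : z ∈ LieSubalgebra.lieSpan F L {x, y} := by rw [hgen]; trivial
    induction hz using LieSubalgebra.lieSpan_induction with
    | mem z hz =>
      have hbasis : (∀ n, f ⁅b n, z⁆ = ⁅f (b n), f z⁆) → ∀ w, f ⁅w, z⁆ = ⁅f w, f z⁆ := by
        intro h w
        have h1 : f ∘ₗ ((LieModule.toEnd F L L z : L →ₗ[F] L)) =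
            (LieModule.toEnd F K K (f z) : K →ₗ[F] K) ∘ₗ f := by
          refine b.ext fun n => ?_
          simp only [LinearMap.comp_apply, LieModule.toEnd_apply_apply]
          rw [← lie_skew, map_neg, h, lie_skew]
        have h2 := LinearMap.congr_fun h1 w
        simp only [LinearMap.comp_apply, LieModule.toEnd_apply_apply] at h2
        rw [← lie_skew, map_neg, h2, lie_skew]
      rcases hz with rfl | rfl
      · refine hbasis fun n => ?_
        rw [hb, hf, hx]
        rcases n with _ | n
        · simp
        · rw [stdSeq_lie_fst (by omega), stdSeq_lie_fst (by omega), hf]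
      · refine hbasis fun n => ?_
        rw [hb, hf, hy]
        rcases n with _ | _ | n
        · rw [zero_add, stdSeq_one, stdSeq_one, ← lie_skew, map_neg, ← lie_skew x']
          have h3 : ⁅z, x⁆ = stdSeq x z 3 := rfl
          have h3' : ⁅y', x'⁆ = stdSeq x' y' 3 := rfl
          rw [h3, h3', hf]
        · simp
        · rw [hβ _ (by omega), hβ' _ (by omega), map_smul, hf]
    | zero => simp
    | add z z' _ _ h1 h2 => intro w; simp [h1, h2]
    | smul c z _ h1 => intro w; simp [h1]
    | lie z z' _ _ h1 h2 =>
      intro w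
      rw [leibniz_lie, map_add, h2, h1, ← lie_skew z, map_neg, h1, h2, h2, lie_skew (f z),
        leibniz_lie (f w)]
  refine ⟨{ f with map_lie' := fun {w z} => key z w }, ⟨hx, hy⟩, ?_⟩
  rintro g ⟨hgx, hgy⟩
  have hg : (g : L →ₗ[F] K) = f := by
    refine b.ext fun n => ?_
    rw [hb, hf, LieHom.coe_toLinearMap, map_stdSeq, hgx, hgy]
  ext z
  exact LinearMap.congr_fun hg z

end StdSeq

/-! ### Grading and lower central series -/

section TypeTwo

variable {F : Type u} [Field F] {L : Type v} [LieRing L] [LieAlgebra F L] {x y : L}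

theorem stdSeq_mem_lowerCentralSeries (k : ℕ) :
    stdSeq x y (k + 2) ∈ LieModule.lowerCentralSeries F L L k := by
  induction k with
  | zero => simp
  | succ k ih =>
    rw [LieModule.lowerCentralSeries_succ, show k + 1 + 2 = k + 2 + 1 by ring,
      ← stdSeq_lie_fst (by omega), ← lie_skew]
    exact neg_mem (LieSubmodule.lie_mem_lie (LieSubmodule.mem_top x) ih)

/-- An inductive criterion for upper bounds of the lower central series. -/
theorem lowerCentralSeries_le_of_lie_mem (T : ℕ → Submodule F L)
    (h1 : ∀ w z : L, ⁅w, z⁆ ∈ T 0) (h : ∀ (k : ℕ) (w z : L), z ∈ T k → ⁅w, z⁆ ∈ T (k + 1))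
    (k : ℕ) : (LieModule.lowerCentralSeries F L L (k + 1)).toSubmodule ≤ T k := by
  induction k with
  | zero =>
    rw [LieModule.lowerCentralSeries_succ, LieSubmodule.lieIdeal_oper_eq_linear_span',
      Submodule.span_le]
    rintro _ ⟨w, -, z, -, rfl⟩
    exact h1 w z
  | succ k ih =>
    rw [LieModule.lowerCentralSeries_succ, LieSubmodule.lieIdeal_oper_eq_linear_span',
      Submodule.span_le]
    rintro _ ⟨w, -, z, hz, rfl⟩
    exact h k w z (ih hz)

/-- The grading of a Lie algebra in which the elements `e_1, e_2, …` are linearly independent. -/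
theorem isInfiniteTypeTwo_span_stdSeq {β : ℕ → F}
    (hgen : LieSubalgebra.lieSpan F L {x, y} = ⊤)
    (hβ : ∀ k, 3 ≤ k → ⁅stdSeq x y k, y⁆ = β k • stdSeq x y (k + 2))
    (hli : LinearIndependent F fun n => stdSeq x y (n + 1)) :
    IsInfiniteTypeTwo F fun i => Submodule.span F {stdSeq x y i} := by
  have hspan := span_stdSeq_eq_top hgen hβ
  have hne : ∀ i, 1 ≤ i → stdSeq x y i ≠ 0 := by
    intro i hi
    obtain ⟨i, rfl⟩ : ∃ j, i = j + 1 := ⟨i - 1, by omega⟩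
    exact hli.ne_zero i
  refine ⟨⟨?_, ?_, ?_, ?_, ?_, ?_, ?_⟩, fun i hi => finrank_span_singleton (hne i hi)⟩
  · refine DirectSum.isInternal_submodule_of_iSupIndep_of_iSup_eq_top ?_ ?_
    -- Since e_0 = 0, the summand of weight 0 is zero. It is discarded first, because the linearly
    -- independent family starts with e_1.
    · rw [← iSupIndep_ne_bot]
      have hpos : ∀ i : {i // Submodule.span F {stdSeq x y i} ≠ ⊥}, 1 ≤ (i : ℕ) := by
        rintro ⟨i, hi⟩
        by_contra h0
        obtain rfl : i = 0 := by simpa using h0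
        simp at hi
      have hcomp := hli.comp
        (fun i : {i // Submodule.span F {stdSeq x y i} ≠ ⊥} => (i : ℕ) - 1) (by
          intro i j hij
          have h1 := hpos i
          have h2 := hpos j
          exact Subtype.ext (by dsimp only at hij; omega))
      convert! hcomp.iSupIndep_span_singleton using 5 with i
      exact congrArg (stdSeq x y) (Nat.sub_add_cancel (hpos i)).symm
    · rw [eq_top_iff, ← hspan, Submodule.span_le]
      rintro _ ⟨n, rfl⟩
      exact Submodule.mem_iSup_of_mem (n + 1) (Submodule.mem_span_singleton_self _)
  · simp
  · intro i j a b ha hb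
    obtain ⟨c, rfl⟩ := Submodule.mem_span_singleton.mp ha
    obtain ⟨d, rfl⟩ := Submodule.mem_span_singleton.mp hb
    rw [smul_lie, lie_smul]
    exact Submodule.smul_mem _ _ (Submodule.smul_mem _ _ (stdSeq_lie_mem_span hβ i j))
  · intro i
    rw [rank_submodule_le_one_iff']
    exact ⟨_, le_rfl⟩
  · intro i hi h
    rw [Submodule.span_singleton_eq_bot] at h
    exact (hne i hi h).elim
  · rw [eq_top_iff, ← hgen]
    refine LieSubalgebra.lieSpan_mono ?_
    rintro z (rfl | rfl)
    · exact Or.inl (Submodule.mem_span_singleton_self _)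
    · exact Or.inr (Submodule.mem_span_singleton_self _)
  · intro k _
    let b := Module.Basis.mk hli hspan.ge
    have hb : ∀ n, b n = stdSeq x y (n + 1) := fun n => Module.Basis.mk_apply _ _ n
    have hTl : ∀ k m, k + 1 ≤ m →
        stdSeq x y m ∈ Submodule.span F (b '' {n | k ≤ n}) := by
      intro k m hm
      obtain ⟨m, rfl⟩ : ∃ j, m = j + 1 := ⟨m - 1, by omega⟩
      exact Submodule.subset_span ⟨m, by simpa using hm, hb m⟩
    have hlie : ∀ k m n, k + 1 ≤ m + n → ⁅stdSeq x y m, stdSeq x y n⁆ ∈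
        Submodule.span F (b '' {n | k ≤ n}) := fun k m n h =>
      (Submodule.span_singleton_le_iff_mem _ _).mpr (hTl k _ h) (stdSeq_lie_mem_span hβ m n)
    have hall : ∀ (T : Submodule F L) (z : L), (∀ n, ⁅stdSeq x y (n + 1), z⁆ ∈ T) →
        ∀ w : L, ⁅w, z⁆ ∈ T := by
      intro T z h w
      have hw : w ∈ Submodule.span F (Set.range fun n => stdSeq x y (n + 1)) := by
        rw [hspan]; trivial
      induction hw using Submodule.span_induction with
      | mem w hw => obtain ⟨n, rfl⟩ := hw; exact h n
      | zero => simp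
      | add w w' _ _ h1 h2 => rw [add_lie]; exact add_mem h1 h2
      | smul c w _ h1 => rw [smul_lie]; exact Submodule.smul_mem _ _ h1
    -- As `b n` is e_{n+1}, the right side is spanned by the e_i with i ≥ k + 3. Weight 2 is already
    -- missing from the derived algebra because [e_1, e_1] = 0.
    have hlcs : (LieModule.lowerCentralSeries F L L (k + 1)).toSubmodule =
        Submodule.span F (b '' {n | k + 2 ≤ n}) := by
      apply le_antisymm
      · refine lowerCentralSeries_le_of_lie_mem
          (fun k => Submodule.span F (b '' {n | k + 2 ≤ n})) ?_ ?_ k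
        · intro w z
          have hz : z ∈ Submodule.span F (Set.range fun n => stdSeq x y (n + 1)) := by
            rw [hspan]; trivial
          refine hall _ _ (fun m => ?_) w
          induction hz using Submodule.span_induction with
          | mem z hz =>
            obtain ⟨n, rfl⟩ := hz
            rcases Nat.eq_zero_or_pos (m + n) with h | h
            · obtain rfl : m = 0 := by omega
              obtain rfl : n = 0 := by omega
              simp
            · exact hlie _ _ _ (by omega)
          | zero => simp
          | add z z' _ _ h1 h2 => rw [lie_add]; exact add_mem h1 h2
          | smul c z _ h1 => rw [lie_smul]; exact Submodule.smul_mem _ _ h1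
        · intro k w z hz
          refine hall _ _ (fun m => ?_) w
          induction hz using Submodule.span_induction with
          | mem z hz =>
            obtain ⟨n, hn, rfl⟩ := hz
            rw [Set.mem_ofPred_eq] at hn
            rw [hb]
            exact hlie _ _ _ (by omega)
          | zero => simp
          | add z z' _ _ h1 h2 => rw [lie_add]; exact add_mem h1 h2
          | smul c z _ h1 => rw [lie_smul]; exact Submodule.smul_mem _ _ h1
      · rw [Submodule.span_le]
        rintro _ ⟨n, hn, rfl⟩
        rw [Set.mem_ofPred_eq] at hn
        rw [hb]
        obtain ⟨n, rfl⟩ : ∃ j, n = j + 1 := ⟨n - 1, by omega⟩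
        exact LieModule.antitone_lowerCentralSeries F L L (by omega : k + 1 ≤ n)
          (stdSeq_mem_lowerCentralSeries n)
    let f : L →ₗ[F] (Fin (k + 2) → F) := LinearMap.pi fun i => b.coord i
    have hker : LinearMap.ker f = Submodule.span F (b '' {n | k + 2 ≤ n}) := by
      ext z
      rw [Module.Basis.mem_span_image, LinearMap.mem_ker]
      constructor
      · intro hz n hn
        rw [Set.mem_ofPred_eq]
        by_contra! hlt
        rw [Finset.mem_coe, Finsupp.mem_support_iff] at hn
        exact hn (congrFun hz ⟨n, hlt⟩)
      · intro hz
        funext i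
        by_contra hne
        have : (i : ℕ) ∈ (b.repr z).support := by
          rw [Finsupp.mem_support_iff]
          exact hne
        have := hz this
        rw [Set.mem_ofPred_eq] at this
        omega
    have hsurj : Function.Surjective f := by
      intro g
      refine ⟨∑ i, g i • b i, ?_⟩
      funext j
      simp only [f, LinearMap.pi_apply, map_sum, map_smul, Module.Basis.coord_apply,
        Module.Basis.repr_self, smul_eq_mul]
      rw [Finset.sum_eq_single j]
      · simp
      · intro i _ hij
        rw [Finsupp.single_apply, if_neg (by simpa [Fin.ext_iff] using hij), mul_zero]
      · simp
    have h1 := ((Submodule.quotEquivOfEq _ _ (hlcs.trans hker.symm)).trans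
      (f.quotKerEquivOfSurjective hsurj)).finrank_eq
    rw [Module.finrank_fin_fun] at h1
    exact h1

variable {𝒜 : ℕ → Submodule F L}

theorem IsStandardPair.stdSeq_mem (h : IsTypeTwo F 𝒜) (hs : IsStandardPair 𝒜 x y) (i : ℕ) :
    stdSeq x y i ∈ 𝒜 i := by
  rcases Nat.lt_or_ge i 2 with hi | hi
  · interval_cases i
    · simp
    · exact hs.fst_mem
  · induction i, hi using Nat.le_induction with
    | base => exact hs.snd_mem
    | succ k hk ih =>
      rw [← stdSeq_lie_fst hk]
      exact h.lie_mem _ _ _ _ ih hs.fst_mem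

theorem IsTypeTwo.exists_smul_eq (h : IsTypeTwo F 𝒜) {i : ℕ} {a : L} (ha : a ∈ 𝒜 i)
    (ha0 : a ≠ 0) {z : L} (hz : z ∈ 𝒜 i) : ∃ c : F, c • a = z := by
  obtain ⟨v, hv⟩ := (rank_submodule_le_one_iff' _).mp (h.rank_le_one i)
  obtain ⟨c, rfl⟩ := Submodule.mem_span_singleton.mp (hv ha)
  obtain ⟨d, rfl⟩ := Submodule.mem_span_singleton.mp (hv hz)
  have hc : c ≠ 0 := by
    rintro rfl
    simp at ha0
  exact ⟨d * c⁻¹, by rw [smul_smul, inv_mul_cancel_right₀ hc]⟩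

theorem IsTypeTwo.ne_bot_of_le (h : IsTypeTwo F 𝒜) {i j : ℕ} (hi : 1 ≤ i) (hij : i ≤ j)
    (hj : 𝒜 j ≠ ⊥) : 𝒜 i ≠ ⊥ := by
  induction j, hij using Nat.le_induction with
  | base => exact hj
  | succ k hk ih =>
    apply ih
    contrapose! hj
    exact h.no_gap k (hi.trans hk) hj

/-- The lower central series of an algebra of type 2, in terms of the grading. -/
theorem IsTypeTwo.lowerCentralSeries_le (h : IsTypeTwo F 𝒜) (hs : IsStandardPair 𝒜 x y)
    (k : ℕ) : (LieModule.lowerCentralSeries F L L (k + 1)).toSubmodule ≤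
      Submodule.span F {stdSeq x y (k + 3)} ⊔ ⨆ i ∈ {i | k + 4 ≤ i}, 𝒜 i := by
  have hU : ∀ {k i : ℕ} {z : L}, z ∈ 𝒜 i → k ≤ i → z ∈ ⨆ i ∈ {i | k ≤ i}, 𝒜 i :=
    fun hz hi => Submodule.mem_iSup_of_mem _ (Submodule.mem_iSup_of_mem hi hz)
  have htop : ∀ (T : Submodule F L) (z : L), (∀ i, 1 ≤ i → ∀ w ∈ 𝒜 i, ⁅w, z⁆ ∈ T) →
      ∀ w : L, ⁅w, z⁆ ∈ T := by
    intro T z hz w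
    have hw : w ∈ ⨆ i, 𝒜 i := by rw [h.internal.submodule_iSup_eq_top]; trivial
    induction hw using Submodule.iSup_induction' with
    | mem i w hw =>
      rcases Nat.eq_zero_or_pos i with rfl | hi
      · rw [h.zero_eq_bot, Submodule.mem_bot] at hw
        simp [hw]
      · exact hz i hi w hw
    | zero => simp
    | add w w' _ _ h1 h2 => rw [add_lie]; exact add_mem h1 h2
  -- A bracket with e_{k+2} has weight k + 3 only if the other factor is a multiple of e_1. Hence
  -- the bound contains the line through e_{k+3} and not the whole component.
  have hstep : ∀ k, ∀ i, 1 ≤ i → ∀ w ∈ 𝒜 i, ⁅w, stdSeq x y (k + 2)⁆ ∈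
      Submodule.span F {stdSeq x y (k + 3)} ⊔ ⨆ i ∈ {i | k + 4 ≤ i}, 𝒜 i := by
    intro k i hi w hw
    rcases Nat.lt_or_ge i 2 with hi2 | hi2
    · obtain rfl : i = 1 := by omega
      obtain ⟨c, rfl⟩ := h.exists_smul_eq hs.fst_mem hs.fst_ne_zero hw
      rw [smul_lie, ← lie_skew, stdSeq_lie_fst (by omega)]
      exact Submodule.mem_sup_left (Submodule.smul_mem _ _ (neg_mem
        (Submodule.mem_span_singleton_self _)))
    · exact Submodule.mem_sup_right
        (hU (h.lie_mem _ _ _ _ hw (hs.stdSeq_mem h _)) (by omega))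
  have hrest : ∀ k z, (z ∈ ⨆ i ∈ {i | k + 3 ≤ i}, 𝒜 i) → ∀ i, 1 ≤ i → ∀ w ∈ 𝒜 i, ⁅w, z⁆ ∈
      Submodule.span F {stdSeq x y (k + 3)} ⊔ ⨆ i ∈ {i | k + 4 ≤ i}, 𝒜 i := by
    intro k z hz i hi w hw
    rw [iSup_subtype'] at hz
    induction hz using Submodule.iSup_induction' with
    | mem j z hz =>
      have := j.2
      rw [Set.mem_ofPred_eq] at this
      exact Submodule.mem_sup_right (hU (h.lie_mem _ _ _ _ hw hz) (by omega))
    | zero => simp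
    | add z z' _ _ h1 h2 => rw [lie_add]; exact add_mem h1 h2
  refine lowerCentralSeries_le_of_lie_mem (fun k => Submodule.span F {stdSeq x y (k + 3)} ⊔
    ⨆ i ∈ {i | k + 4 ≤ i}, 𝒜 i) ?_ ?_ k
  · intro w z
    refine htop _ _ (fun i hi w hw => ?_) w
    have hz : z ∈ ⨆ i, 𝒜 i := by rw [h.internal.submodule_iSup_eq_top]; trivial
    induction hz using Submodule.iSup_induction' with
    | mem j z hz =>
      rcases Nat.lt_or_ge j 3 with hj | hj
      · interval_cases j
        · rw [h.zero_eq_bot, Submodule.mem_bot] at hz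
          simp [hz]
        · obtain ⟨c, rfl⟩ := h.exists_smul_eq hs.fst_mem hs.fst_ne_zero hz
          rcases Nat.lt_or_ge i 3 with hi3 | hi3
          · rcases Nat.lt_or_ge i 2 with hi2 | hi2
            · obtain rfl : i = 1 := by omega
              obtain ⟨d, rfl⟩ := h.exists_smul_eq hs.fst_mem hs.fst_ne_zero hw
              simp
            · obtain rfl : i = 2 := by omega
              obtain ⟨d, rfl⟩ := h.exists_smul_eq hs.snd_mem hs.snd_ne_zero hw
              rw [smul_lie, lie_smul]
              exact Submodule.mem_sup_left (Submodule.smul_mem _ _ (Submodule.smul_mem _ _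
                (Submodule.mem_span_singleton_self _)))
          · exact Submodule.mem_sup_right (hU (h.lie_mem _ _ _ _ hw
              (Submodule.smul_mem _ c hs.fst_mem)) (by omega))
        · obtain ⟨c, rfl⟩ := h.exists_smul_eq hs.snd_mem hs.snd_ne_zero hz
          rw [lie_smul]
          exact Submodule.smul_mem _ _ (hstep 0 i hi w hw)
      · exact Submodule.mem_sup_right (hU (h.lie_mem _ _ _ _ hw hz) (by omega))
    | zero => simp
    | add z z' _ _ h1 h2 => rw [lie_add]; exact add_mem h1 h2
  · intro k w z hz
    refine htop _ _ (fun i hi w hw => ?_) w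
    obtain ⟨a, ha, u, hu, rfl⟩ := Submodule.mem_sup.mp hz
    obtain ⟨c, rfl⟩ := Submodule.mem_span_singleton.mp ha
    rw [lie_add, lie_smul]
    exact add_mem (Submodule.smul_mem _ _ (hstep (k + 1) i hi w hw)) (hrest (k + 1) u hu i hi w hw)

/-- In an algebra of type 2, the nonzero components are spanned by the standard sequence. -/
theorem IsTypeTwo.stdSeq_ne_zero (h : IsTypeTwo F 𝒜) (hs : IsStandardPair 𝒜 x y) (i : ℕ)
    (hi : 𝒜 i ≠ ⊥) : stdSeq x y i ≠ 0 := by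
  rcases Nat.lt_or_ge i 2 with hi2 | hi2
  · interval_cases i
    · exact (hi h.zero_eq_bot).elim
    · exact hs.fst_ne_zero
  obtain ⟨i, rfl⟩ : ∃ k, i = k + 2 := ⟨i - 2, by omega⟩
  induction i with
  | zero => exact hs.snd_ne_zero
  | succ k ih =>
    intro h0
    have hk := ih (h.ne_bot_of_le (by omega) (by omega) hi) (by omega)
    have hlcs : LieModule.lowerCentralSeries F L L k ≠ ⊥ := by
      intro hbot
      have := stdSeq_mem_lowerCentralSeries (F := F) (x := x) (y := y) k
      rw [hbot, LieSubmodule.mem_bot] at this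
      exact hk this
    have hfr : Module.finrank F (L ⧸ (LieModule.lowerCentralSeries F L L (k + 1)).toSubmodule) =
      k + 2 := h.maximal_class k hlcs
    -- Finiteness has to be derived: `finrank` is 0 by convention on infinite-dimensional spaces,
    -- and here it is k + 2.
    have := Module.finite_of_finrank_pos (by rw [hfr]; omega : 0 < Module.finrank F
      (L ⧸ (LieModule.lowerCentralSeries F L L (k + 1)).toSubmodule))
    have hle := h.lowerCentralSeries_le hs k
    -- If e_{k+3} = 0, the Lie power L^{k+2} lies in weights ≥ k + 4. Nonzero elements of weights 1,
    -- …, k + 3 are then independent modulo it, against its codimension k + 2.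
    rw [show k + 3 = k + 1 + 2 by ring, h0, Submodule.span_zero_singleton, bot_sup_eq] at hle
    have hex : ∀ j : Fin (k + 3), ∃ a ∈ 𝒜 (j + 1), a ≠ 0 := fun j =>
      Submodule.exists_mem_ne_zero_of_ne_bot (h.ne_bot_of_le (by omega) (by omega) hi)
    choose a ha ha0 using hex
    have hind := h.internal.submodule_iSupIndep
    have hli : LinearIndependent F a :=
      (hind.comp (f := fun j : Fin (k + 3) => (j : ℕ) + 1)
        (fun j j' hjj => Fin.ext (by simpa using hjj))).linearIndependent _ ha ha0
    have hdisj := hind.disjoint_biSup_biSup (s := {i | i < k + 4}) (t := {i | k + 4 ≤ i})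
      (Set.disjoint_left.mpr fun i h1 h2 => by
        rw [Set.mem_ofPred_eq] at h1 h2; omega)
    have hli' := hli.map (f := (LieModule.lowerCentralSeries F L L (k + 1)).toSubmodule.mkQ) (by
      rw [Submodule.ker_mkQ]
      refine hdisj.mono ?_ hle
      rw [Submodule.span_le]
      rintro _ ⟨j, rfl⟩
      exact Submodule.mem_iSup_of_mem (j + 1 : ℕ) (Submodule.mem_iSup_of_mem
        (by rw [Set.mem_ofPred_eq]; omega) (ha j)))
    have := hli'.fintype_card_le_finrank
    rw [Fintype.card_fin, hfr] at this
    omega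

theorem IsTypeTwo.exists_smul_stdSeq (h : IsTypeTwo F 𝒜) (hs : IsStandardPair 𝒜 x y) {i : ℕ}
    {z : L} (hz : z ∈ 𝒜 i) : ∃ c : F, c • stdSeq x y i = z := by
  by_cases hi : 𝒜 i = ⊥
  · rw [hi, Submodule.mem_bot] at hz
    exact ⟨0, by simp [hz]⟩
  · exact h.exists_smul_eq (hs.stdSeq_mem h i) (h.stdSeq_ne_zero hs i hi) hz

/-- The coefficients in the relations `[e_k, e_2] = β_k e_{k+2}`. -/
theorem IsTypeTwo.exists_coeff (h : IsTypeTwo F 𝒜) (hs : IsStandardPair 𝒜 x y) :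
    ∃ β : ℕ → F, β 2 = 0 ∧ ∀ k, 2 ≤ k → ⁅stdSeq x y k, y⁆ = β k • stdSeq x y (k + 2) := by
  have hex : ∀ k, ∃ c : F, c • stdSeq x y (k + 2) = ⁅stdSeq x y k, y⁆ := fun k =>
    h.exists_smul_stdSeq hs (h.lie_mem _ _ _ _ (hs.stdSeq_mem h k) hs.snd_mem)
  choose β hβ using hex
  refine ⟨fun k => if k = 2 then 0 else β k, by simp, ?_⟩
  exact stdSeq_lie_snd_eq_extension fun k _ => (hβ k).symm

/-- For N = k + 3 the power L^{k+2} lies in weights ≥ k + 4, and a nonzero component there would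
make e_N nonzero. -/
theorem IsTypeTwo.isNilpotent (h : IsTypeTwo F 𝒜) (hs : IsStandardPair 𝒜 x y) {N : ℕ}
    (hN : 3 ≤ N) (h0 : stdSeq x y N = 0) : LieRing.IsNilpotent L := by
  obtain ⟨k, rfl⟩ : ∃ k, N = k + 3 := ⟨N - 3, by omega⟩
  refine (LieModule.isNilpotent_iff F L L).mpr ⟨k + 1, ?_⟩
  have hle := h.lowerCentralSeries_le hs k
  rw [h0, Submodule.span_zero_singleton, bot_sup_eq] at hle
  have hbot : ⨆ i ∈ {i | k + 4 ≤ i}, 𝒜 i = ⊥ := by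
    simp only [iSup_eq_bot]
    intro i hi
    rw [Set.mem_ofPred_eq] at hi
    by_contra hne
    exact h.stdSeq_ne_zero hs (k + 3) (h.ne_bot_of_le (by omega) (by omega) hne) h0
  rw [hbot, le_bot_iff] at hle
  exact (LieSubmodule.toSubmodule_eq_bot _).mp hle

theorem IsInfiniteTypeTwo.stdSeq_ne_zero (h : IsInfiniteTypeTwo F 𝒜)
    (hs : IsStandardPair 𝒜 x y) {i : ℕ} (hi : 1 ≤ i) : stdSeq x y i ≠ 0 := by
  refine h.toIsTypeTwo.stdSeq_ne_zero hs i fun hbot => ?_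
  have := h.finrank_eq_one i hi
  rw [hbot, finrank_bot] at this
  omega

theorem IsInfiniteTypeTwo.linearIndependent_stdSeq (h : IsInfiniteTypeTwo F 𝒜)
    (hs : IsStandardPair 𝒜 x y) : LinearIndependent F fun n => stdSeq x y (n + 1) :=
  (h.internal.submodule_iSupIndep.comp (f := fun n : ℕ => n + 1)
    (add_left_injective 1)).linearIndependent _ (fun n => hs.stdSeq_mem h.toIsTypeTwo (n + 1))
    fun _ => h.stdSeq_ne_zero hs (by omega)

theorem IsTypeTwo.lieSpan_eq_top (h : IsTypeTwo F 𝒜) (hs : IsStandardPair 𝒜 x y) :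
    LieSubalgebra.lieSpan F L {x, y} = ⊤ := by
  rw [eq_top_iff, ← h.generated, LieSubalgebra.lieSpan_le]
  rintro z (hz | hz)
  · obtain ⟨c, rfl⟩ := h.exists_smul_eq hs.fst_mem hs.fst_ne_zero hz
    exact (LieSubalgebra.lieSpan F L {x, y}).smul_mem c (LieSubalgebra.subset_lieSpan (by simp))
  · obtain ⟨c, rfl⟩ := h.exists_smul_eq hs.snd_mem hs.snd_ne_zero hz
    exact (LieSubalgebra.lieSpan F L {x, y}).smul_mem c (LieSubalgebra.subset_lieSpan (by simp))

end TypeTwo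

/-! ### The periodic weights of D and their differences -/

section Delta

variable {F : Type u} [Field F] {p q : ℕ}

/-- The coefficients of `D` with respect to the vectors `vecW`. -/
def opCoeff (F : Type u) [Field F] (q m : ℕ) : F :=
  if q ∣ m then 1 else if q ∣ m + 1 then -1 else 0

theorem opCoeff_mul (c : ℕ) : opCoeff F q (c * q) = 1 := by simp [opCoeff]

theorem opCoeff_mul_add_pred (hq : 1 < q) (c : ℕ) : opCoeff F q (c * q + (q - 1)) = -1 := by
  have h1 : ¬ q ∣ c * q + (q - 1) := by
    rw [Nat.dvd_add_right (Dvd.intro_left c rfl)]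
    exact Nat.not_dvd_of_pos_of_lt (by omega) (by omega)
  have h2 : q ∣ c * q + (q - 1) + 1 := by
    rw [add_assoc, Nat.sub_add_cancel hq.le]
    exact Dvd.intro_left (c + 1) (by ring)
  simp [opCoeff, h1, h2]

theorem opCoeff_eq_zero (c : ℕ) {m : ℕ} (h1 : c * q < m) (h2 : m + 1 < c * q + q) :
    opCoeff F q m = 0 := by
  obtain ⟨m, rfl⟩ : ∃ l, m = c * q + l := ⟨m - c * q, by omega⟩
  have h3 : ¬ q ∣ c * q + m := by
    rw [Nat.dvd_add_right (Dvd.intro_left c rfl)]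
    exact Nat.not_dvd_of_pos_of_lt (by omega) (by omega)
  have h4 : ¬ q ∣ c * q + m + 1 := by
    rw [add_assoc, Nat.dvd_add_right (Dvd.intro_left c rfl)]
    exact Nat.not_dvd_of_pos_of_lt (by omega) (by omega)
  simp [opCoeff, h3, h4]

theorem lieCoeff_opCoeff_add (k m c : ℕ) :
    lieCoeff (opCoeff F q) k (m + c * q) = lieCoeff (opCoeff F q) k m := by
  have h : ∀ n, q ∣ n + c * q ↔ q ∣ n := fun n => Nat.dvd_add_left (Dvd.intro_left c rfl)
  induction k generalizing m with
  | zero => simp [opCoeff, h, show m + c * q + 1 = m + 1 + c * q by ring]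
  | succ k ih => rw [lieCoeff_succ, lieCoeff_succ, ih, ← ih (m + 1), show
      m + c * q + 1 = m + 1 + c * q by ring]

theorem opCoeff_add (m c : ℕ) : opCoeff F q (m + c * q) = opCoeff F q m :=
  lieCoeff_opCoeff_add 0 m c

/-- A difference of order q - 1 sums the weights over a full period, which contains 1 and -1 once
each; higher orders are differences of zeros. -/
theorem lieCoeff_opCoeff_eq_zero (hF : IsOddCharPower F p q) {k : ℕ} (hk : q ≤ k + 1) (m : ℕ) :
    lieCoeff (opCoeff F q) k m = 0 := by
  have h5 := hF.five_le
  rw [← Nat.mod_add_div m q, mul_comm q, lieCoeff_opCoeff_add]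
  have hm : m % q < q := Nat.mod_lt _ (by omega)
  generalize m % q = r at hm
  obtain ⟨k, rfl⟩ : ∃ l, k = q - 1 + l := ⟨k - (q - 1), by omega⟩
  induction k generalizing r with
  | zero =>
    have z0 := opCoeff_mul (F := F) (q := q) 0
    have z1 := opCoeff_mul (F := F) (q := q) 1
    have z2 := opCoeff_mul_add_pred (F := F) (q := q) (by omega) 0
    simp only [zero_mul, one_mul, zero_add] at z0 z1 z2
    rcases Nat.eq_zero_or_pos r with rfl | hr
    · rw [add_zero, hF.lieCoeff_pred _ 0 0 (q - 1) le_rfl (by omega) (by omega)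
        fun i h1 h2 h3 h4 => opCoeff_eq_zero 0 (by omega) (by omega), z0, z2]
      ring
    · rw [add_zero, hF.lieCoeff_pred _ r (q - 1) q (by omega) (by omega) (by omega)
        fun i h1 h2 h3 h4 => (Nat.lt_or_ge i q).elim
          (fun h => opCoeff_eq_zero 0 (by omega) (by omega))
          (fun h => opCoeff_eq_zero 1 (by omega) (by omega)), z1, z2]
      ring
  | succ k ih =>
    rw [← add_assoc, lieCoeff_succ, ih r hm (by omega)]
    rcases Nat.lt_or_ge (r + 1) q with h | h
    · rw [ih _ h (by omega), sub_zero]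
    · rw [show r + 1 = 0 + 1 * q by omega, lieCoeff_opCoeff_add, ih 0 (by omega) (by omega),
        sub_zero]

/-- This is the vector part of [e_{k+2}, e_2] = μ_{k+2} e_{k+4}. The exceptional value μ_q = 1
arises because k = q - 2 is the only order k ≥ 1 at which the difference at 1 is nonzero, and there
both terms contribute -1. -/
theorem opCoeff_sub_lieCoeff (hF : IsOddCharPower F p q) {k : ℕ} (hk : 1 ≤ k) :
    opCoeff F q (k + 1) - lieCoeff (opCoeff F q) k 1 = -(2 * extraCoeff F q (k + 2)) := by
  have h5 := hF.five_le
  have h2 := hF.two_ne_zero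
  have z2 := opCoeff_mul_add_pred (F := F) (q := q) (by omega) 0
  simp only [zero_mul, zero_add] at z2
  rcases Nat.lt_trichotomy (k + 2) q with h | h | h
  · rw [extraCoeff_eq_zero (i := 0) (by omega) (by omega),
      opCoeff_eq_zero 0 (by omega) (by omega),
      lieCoeff_eq_zero _ _ _ fun j hj => opCoeff_eq_zero 0 (by omega) (by omega)]
    ring
  · rw [lieCoeff_eq_last _ k 1 fun j hj => opCoeff_eq_zero 0 (by omega) (by omega),
      Odd.neg_one_pow (by obtain ⟨l, hl⟩ := hF.odd; exact ⟨l - 1, by omega⟩),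
      add_comm 1 k, show k + 1 = q - 1 by omega, z2, h, extraCoeff_self]
    ring
  · rw [lieCoeff_opCoeff_eq_zero hF (by omega), sub_zero]
    obtain ⟨c, r, hr, hcr⟩ : ∃ c r, r < q ∧ k + 2 = c * q + r :=
      ⟨(k + 2) / q, (k + 2) % q, Nat.mod_lt _ (by omega), by
        rw [mul_comm]; exact (Nat.div_add_mod _ _).symm⟩
    have hc : 1 ≤ c := by
      rcases Nat.eq_zero_or_pos c with rfl | hc
      · omega
      · exact hc
    rcases Nat.lt_or_ge r 2 with h0 | h0
    · interval_cases r
      · have hc2 : 2 ≤ c := by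
          rcases Nat.lt_or_ge c 2 with hc2 | hc2
          · obtain rfl : c = 1 := by omega
            omega
          · exact hc2
        obtain ⟨c, rfl⟩ : ∃ d, c = d + 1 := ⟨c - 1, by omega⟩
        rw [hcr, add_zero, extraCoeff_mul (by omega) hc2]
        rw [add_mul, one_mul] at hcr
        rw [show k + 1 = c * q + (q - 1) by omega, opCoeff_mul_add_pred (by omega)]
        field_simp
      · rw [hcr, extraCoeff_mul_add_one (by omega) hc, show k + 1 = c * q by omega,
          opCoeff_mul]
        field_simp
    · rw [extraCoeff_eq_zero (i := c) (by omega) (by omega),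
        opCoeff_eq_zero c (by omega) (by omega)]
      ring

/-- Read off on w_m, this says that the operator parts of e_{k+2} and e_2 commute for k ≥ 1. Both
sides vanish unless m ≡ 0 or -1 modulo q, and in these cases the binomial coefficients simplify
because q = 0 in F. -/
theorem lieCoeff_opCoeff_mul (hF : IsOddCharPower F p q) {k : ℕ} (hk : 1 ≤ k) (m : ℕ) :
    lieCoeff (opCoeff F q) k m * opCoeff F q (m + k + 2) =
      opCoeff F q m * lieCoeff (opCoeff F q) k (m + 2) := by
  have h5 := hF.five_le
  have hq0 := hF.cast_eq_zero
  rcases Nat.lt_or_ge q (k + 2) with h | h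
  · rw [lieCoeff_opCoeff_eq_zero hF (by omega), lieCoeff_opCoeff_eq_zero hF (by omega)]
    ring
  rw [← Nat.mod_add_div m q, mul_comm q]
  have hm : m % q < q := Nat.mod_lt _ (by omega)
  generalize m % q = r at hm
  generalize m / q = c
  rw [show r + c * q + k + 2 = r + k + 2 + c * q by ring,
    show r + c * q + 2 = r + 2 + c * q by ring, opCoeff_add, opCoeff_add, lieCoeff_opCoeff_add,
    lieCoeff_opCoeff_add]
  have z0 := opCoeff_mul (F := F) (q := q) 0
  have z1 := opCoeff_mul (F := F) (q := q) 1
  have z2 := opCoeff_mul_add_pred (F := F) (q := q) (by omega) 0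
  have z3 := opCoeff_mul_add_pred (F := F) (q := q) (by omega) 1
  simp only [zero_mul, one_mul, zero_add] at z0 z1 z2 z3
  rcases Nat.eq_zero_or_pos r with rfl | hr
  · rw [lieCoeff_eq_head _ k 0 fun j h1 h2 => opCoeff_eq_zero 0 (by omega) (by omega), zero_add,
      zero_add, z0]
    rcases Nat.lt_trichotomy (k + 3) q with h' | h' | h'
    · rw [opCoeff_eq_zero 0 (by omega) (by omega),
        lieCoeff_eq_zero _ _ _ fun j hj => opCoeff_eq_zero 0 (by omega) (by omega)]
    · rw [lieCoeff_eq_last _ k 2 fun j hj => opCoeff_eq_zero 0 (by omega) (by omega),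
        Even.neg_one_pow (by obtain ⟨l, hl⟩ := hF.odd; exact ⟨l - 1, by omega⟩), add_comm 2 k]
      ring
    · obtain ⟨k, rfl⟩ : ∃ l, k = l + 1 := ⟨k - 1, by omega⟩
      rw [lieCoeff_eq_last_two _ k 2 fun j hj => opCoeff_eq_zero 0 (by omega) (by omega),
        Even.neg_one_pow (by obtain ⟨l, hl⟩ := hF.odd; exact ⟨l - 1, by omega⟩),
        show 2 + k + 1 = q by omega, show 2 + k = q - 1 by omega, show k + 1 + 2 = q by omega,
        z1, z2, show k = q - 3 by omega, Nat.cast_sub (by omega), hq0]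
      push_cast
      ring
  rcases Nat.lt_or_ge (r + 1) q with hr1 | hr1
  · rw [opCoeff_eq_zero 0 (m := r) (by omega) (by omega), zero_mul]
    rcases Nat.lt_or_ge (r + k + 1) q with h' | h'
    · rw [lieCoeff_eq_zero _ _ _ fun j hj => opCoeff_eq_zero 0 (by omega) (by omega), zero_mul]
    · rw [opCoeff_eq_zero 1 (by omega) (by omega), mul_zero]
  · obtain rfl : r = q - 1 := by omega
    rcases Nat.lt_or_ge (k + 2) q with h' | h'
    · rw [opCoeff_eq_zero 1 (m := q - 1 + k + 2) (by omega) (by omega),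
        lieCoeff_eq_zero _ _ (q - 1 + 2) fun j hj => opCoeff_eq_zero 1 (by omega) (by omega)]
      ring
    · obtain rfl : k = q - 2 := by omega
      rw [lieCoeff_eq_head_two _ _ _ fun j h1 h2 => opCoeff_eq_zero 1 (by omega) (by omega),
        lieCoeff_eq_last _ _ _ fun j hj => opCoeff_eq_zero 1 (by omega) (by omega),
        Odd.neg_one_pow (by obtain ⟨l, hl⟩ := hF.odd; exact ⟨l - 1, by omega⟩),
        show q - 1 + 1 = q by omega, show q - 1 + (q - 2) + 2 = q + (q - 1) by omega,
        show q - 1 + 2 + (q - 2) = q + (q - 1) by omega, z1, z2, z3, Nat.cast_sub (by omega), hq0]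
      push_cast
      ring

end Delta

/-! ### The algebra inside V + End(V) -/

section Construction

variable {F : Type u} [Field F] {p q : ℕ}

theorem vecV_eq_single {i : ℕ} (hi : i < q) : vecV F q i = Pi.single ⟨i, hi⟩ 1 := by
  funext j
  simp [vecV, Pi.single_apply, Fin.ext_iff]

theorem opE_vecV {i : ℕ} (hi : i < q) : opE F q (vecV F q i) =
    if i = q - 1 then (RatFunc.X : RatFunc F) • vecV F q 0 else vecV F q (i + 1) := by
  rw [vecV_eq_single hi, ← Pi.basisFun_apply, opE, Module.Basis.constr_basis]

theorem opD_vecV {i : ℕ} (hi : i < q) : opD F q (vecV F q i) =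
    if i = 0 then vecV F q 2
    else if i = q - 1 then -((RatFunc.X : RatFunc F) • vecV F q 1) else 0 := by
  rw [vecV_eq_single hi, ← Pi.basisFun_apply, opD, Module.Basis.constr_basis]

/-- The vectors `t ^ k v_i`, numbered consecutively, with `t⁻¹ v_0` as number `0`. -/
def vecW (F : Type u) [Field F] (q m : ℕ) : Fin q → RatFunc F :=
  ((RatFunc.X : RatFunc F) ^ (m / q) * RatFunc.X⁻¹) • vecV F q (m % q)

theorem vecW_eq {c r : ℕ} (hr : r < q) :
    vecW F q (c * q + r) = ((RatFunc.X : RatFunc F) ^ c * RatFunc.X⁻¹) • vecV F q r := by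
  have h1 : (c * q + r) / q = c := by
    rw [mul_comm, Nat.mul_add_div (by omega), Nat.div_eq_of_lt hr, add_zero]
  have h2 : (c * q + r) % q = r := by
    rw [add_comm, Nat.add_mul_mod_self_right, Nat.mod_eq_of_lt hr]
  rw [vecW, h1, h2]

theorem exists_eq_mul_add (hq : 0 < q) (m : ℕ) : ∃ c r, r < q ∧ m = c * q + r :=
  ⟨m / q, m % q, Nat.mod_lt m hq, by rw [mul_comm]; exact (Nat.div_add_mod _ _).symm⟩

theorem opE_vecW (hq : 3 < q) (m : ℕ) : opE F q (vecW F q m) = vecW F q (m + 1) := by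
  obtain ⟨c, r, hr, rfl⟩ := exists_eq_mul_add (by omega : 0 < q) m
  rw [vecW_eq hr, map_smul, opE_vecV hr]
  split_ifs with h
  · rw [show c * q + r + 1 = (c + 1) * q + 0 by rw [add_mul]; omega, vecW_eq (by omega), smul_smul]
    congr 1
    ring
  · rw [add_assoc, vecW_eq (by omega)]

theorem opD_vecW (hq : 3 < q) (m : ℕ) :
    opD F q (vecW F q m) = opCoeff F q m • vecW F q (m + 2) := by
  obtain ⟨c, r, hr, rfl⟩ := exists_eq_mul_add (by omega : 0 < q) m
  rw [vecW_eq hr, map_smul, opD_vecV hr]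
  split_ifs with h h
  · subst h
    rw [add_zero, opCoeff_mul, one_smul, vecW_eq (by omega)]
  · rw [h, opCoeff_mul_add_pred (by omega),
      show c * q + (q - 1) + 2 = (c + 1) * q + 1 by rw [add_mul]; omega, vecW_eq (by omega),
      neg_smul, one_smul, smul_neg, smul_smul]
    congr 2
    ring
  · rw [opCoeff_eq_zero c (by omega) (by omega), zero_smul, smul_zero]

/-- Among the w_m are w_q, …, w_{2q-1}, which are v_0, …, v_{q-1}, a basis over F(t). -/
theorem end_ext_vecW {A B : Module.End (RatFunc F) (Fin q → RatFunc F)}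
    (h : ∀ m, A (vecW F q m) = B (vecW F q m)) : A = B := by
  refine (Pi.basisFun (RatFunc F) (Fin q)).ext fun i => ?_
  have hv : (Pi.basisFun (RatFunc F) (Fin q)) i = vecW F q (1 * q + i) := by
    rw [vecW_eq i.2, pow_one, mul_inv_cancel₀ RatFunc.X_ne_zero, one_smul, vecV_eq_single i.2,
      Pi.basisFun_apply]
  rw [hv, h]

theorem linearIndependent_vecW (hq : 0 < q) : LinearIndependent F fun m => vecW F q m := by
  have hpow : LinearIndependent F fun k : ℕ => (RatFunc.X : RatFunc F) ^ k * RatFunc.X⁻¹ := by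
    have h1 : LinearIndependent F fun k : ℕ => (Polynomial.X : Polynomial F) ^ k := by
      have := (Polynomial.basisMonomials F).linearIndependent
      simpa [Polynomial.coe_basisMonomials, Polynomial.X_pow_eq_monomial] using this
    have h2 := h1.map' (IsScalarTower.toAlgHom F (Polynomial F) (RatFunc F)).toLinearMap
      (LinearMap.ker_eq_bot.mpr (RatFunc.algebraMap_injective F))
    have h3 := h2.map' (LinearMap.mulRight F (RatFunc.X : RatFunc F)⁻¹)
      (LinearMap.ker_eq_bot.mpr (mul_left_injective₀ (inv_ne_zero RatFunc.X_ne_zero)))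
    convert! h3 using 1
    funext k
    simp
  have h := Pi.linearIndependent_single (η := Fin q) (ιs := fun _ => ℕ)
    (Ms := fun _ => RatFunc F) (R := F) (fun _ k => (RatFunc.X : RatFunc F) ^ k * RatFunc.X⁻¹)
    fun _ => hpow
  have h' := h.comp (fun m : ℕ => ⟨⟨m % q, Nat.mod_lt _ hq⟩, m / q⟩) (by
    intro a b hab
    simp only [Sigma.mk.injEq, Fin.mk.injEq, heq_eq_eq] at hab
    rw [← Nat.mod_add_div a q, ← Nat.mod_add_div b q, hab.1, hab.2])
  convert! h' using 1
  funext m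
  rw [vecW, vecV_eq_single (Nat.mod_lt _ hq)]
  funext j
  simp [Pi.single_apply]

theorem vecW_ne_zero (hq : 0 < q) (m : ℕ) : vecW F q m ≠ 0 :=
  (linearIndependent_vecW hq).ne_zero m

@[simp] theorem vec_genOne : (genOne F q).vec = 0 := rfl

@[simp] theorem op_genOne : (genOne F q).op = opE F q := rfl

theorem algebraMap_half : algebraMap F (RatFunc F) (1 / 2) = 1 / 2 := by
  rw [map_div₀, map_one, map_ofNat]

theorem vec_genTwo (hq : 3 < q) : (genTwo F q).vec = -((1 / 2 : F) • vecW F q 1) := by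
  have h1 : vecW F q 1 = (RatFunc.X : RatFunc F)⁻¹ • vecV F q 1 := by
    have := vecW_eq (F := F) (q := q) (c := 0) (r := 1) (by omega)
    simpa using this
  rw [h1, genTwo, ← algebraMap_smul (RatFunc F) (1 / 2 : F), smul_smul,
    algebraMap_half]
  rw [one_div, one_div, mul_inv]

theorem op_genTwo_vecW (hq : 3 < q) (m : ℕ) : (genTwo F q).op (vecW F q m) =
    (-(1 / 2) * opCoeff F q m) • vecW F q (m + 2) := by
  rw [mul_smul, ← opD_vecW hq, neg_smul, ← algebraMap_smul (RatFunc F) (1 / 2 : F), algebraMap_half]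
  rfl

theorem vec_stdSeq (hq : 3 < q) (k : ℕ) :
    (stdSeq (genOne F q) (genTwo F q) (k + 2)).vec = -((1 / 2 : F) • vecW F q (k + 1)) := by
  induction k with
  | zero => exact vec_genTwo hq
  | succ k ih =>
    rw [show k + 1 + 2 = k + 2 + 1 by ring, ← stdSeq_lie_fst (by omega), SemiEnd.vec_lie, ih]
    simp only [vec_genOne, op_genOne, map_zero, sub_zero, map_neg, LinearMap.map_smul_of_tower, opE_vecW hq]

/-- Bracketing a weighted shift with the shift E takes a difference of its weights, so `lieCoeff`
describes the operators as well as the structure constants. -/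
theorem op_stdSeq_vecW (hq : 3 < q) (k m : ℕ) :
    (stdSeq (genOne F q) (genTwo F q) (k + 2)).op (vecW F q m) =
      (-(1 / 2) * lieCoeff (opCoeff F q) k m) • vecW F q (m + k + 2) := by
  induction k generalizing m with
  | zero => exact op_genTwo_vecW hq m
  | succ k ih =>
    rw [show k + 1 + 2 = k + 2 + 1 by ring, ← stdSeq_lie_fst (by omega), SemiEnd.op_lie]
    simp only [op_genOne, LinearMap.sub_apply, Module.End.mul_apply, ih,
      LinearMap.map_smul_of_tower, opE_vecW hq]
    rw [lieCoeff_succ, mul_sub, sub_smul, show m + 1 + k + 2 = m + (k + 1) + 2 by ring,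
      show m + k + 2 + 1 = m + (k + 1) + 2 by ring]

theorem op_stdSeq_eq_zero (hF : IsOddCharPower F p q) {n : ℕ} (hn : q < n) :
    (stdSeq (genOne F q) (genTwo F q) n).op = 0 := by
  have h5 := hF.five_le
  obtain ⟨k, rfl⟩ : ∃ k, n = k + 2 := ⟨n - 2, by omega⟩
  refine end_ext_vecW fun m => ?_
  rw [op_stdSeq_vecW (by omega), lieCoeff_opCoeff_eq_zero hF (by omega)]
  simp

theorem stdSeq_gen_lie_snd (hF : IsOddCharPower F p q) {n : ℕ} (hn : 3 ≤ n) :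
    ⁅stdSeq (genOne F q) (genTwo F q) n, genTwo F q⁆ =
      extraCoeff F q n • stdSeq (genOne F q) (genTwo F q) (n + 2) := by
  have h5 := hF.five_le
  have h2 := hF.two_ne_zero
  have h4 : (4 : F) ≠ 0 := by
    have : (4 : F) = 2 * 2 := by norm_num
    rw [this]
    exact mul_ne_zero h2 h2
  obtain ⟨k, rfl⟩ : ∃ k, n = k + 2 := ⟨n - 2, by omega⟩
  ext1
  · rw [SemiEnd.vec_lie, SemiEnd.vec_smul, vec_stdSeq (by omega), vec_stdSeq (by omega),
      vec_genTwo (by omega), map_neg, map_neg, LinearMap.map_smul_of_tower,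
      LinearMap.map_smul_of_tower, op_genTwo_vecW (by omega), op_stdSeq_vecW (by omega),
      show 1 + k + 2 = k + 1 + 2 by ring, show k + 2 + 1 = k + 1 + 2 by ring, smul_smul, smul_smul,
      ← neg_smul, ← neg_smul, ← neg_smul, ← sub_smul, smul_smul]
    congr 1
    have h := opCoeff_sub_lieCoeff hF (k := k) (by omega)
    field_simp
    linear_combination h
  · refine end_ext_vecW fun m => ?_
    rw [SemiEnd.op_lie, SemiEnd.op_smul, LinearMap.sub_apply, Module.End.mul_apply,
      Module.End.mul_apply, LinearMap.smul_apply, op_stdSeq_vecW (by omega),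
      op_stdSeq_vecW (by omega), op_genTwo_vecW (by omega), LinearMap.map_smul_of_tower,
      LinearMap.map_smul_of_tower, op_genTwo_vecW (by omega), op_stdSeq_vecW (by omega)]
    -- The operator part of the right side is always zero: below weight q the coefficient vanishes,
    -- and from there on the difference does.
    have h0 : extraCoeff F q (k + 2) * lieCoeff (opCoeff F q) (k + 2) m = 0 := by
      rcases Nat.lt_or_ge (k + 2) q with h | h
      · rw [extraCoeff_eq_zero (i := 0) (by omega) (by omega), zero_mul]
      · rw [lieCoeff_opCoeff_eq_zero hF (by omega), mul_zero]
    rw [smul_smul, smul_smul, smul_smul, show m + 2 + k + 2 = m + (k + 2) + 2 by ring,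
      show m + k + 2 + 2 = m + (k + 2) + 2 by ring, ← sub_smul, ← add_assoc]
    congr 1
    have h := lieCoeff_opCoeff_mul hF (k := k) (by omega) m
    linear_combination (1 / 2 : F) * (1 / 2) * h + 1 / 2 * h0

/-- The vector parts are independent for weights ≥ 2. Only e_1 has vector part zero, and it is
detected by E ≠ 0. -/
theorem linearIndependent_stdSeq_gen (hF : IsOddCharPower F p q) :
    LinearIndependent F fun n => stdSeq (genOne F q) (genTwo F q) (n + 1) := by
  have h5 := hF.five_le
  have h2 := hF.two_ne_zero
  rw [linearIndependent_iff']
  intro s g hg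
  let vecL : SemiEnd (RatFunc F) (Fin q → RatFunc F) →ₗ[F] (Fin q → RatFunc F) :=
    { toFun := SemiEnd.vec, map_add' := fun _ _ => rfl, map_smul' := fun _ _ => rfl }
  have hv : ∀ n, vecL (stdSeq (genOne F q) (genTwo F q) (n + 1)) =
      (if n = 0 then 0 else -(1 / 2) : F) • vecW F q n := by
    intro n
    rcases n with _ | n
    · change (genOne F q).vec = _
      simp
    · rw [if_neg (by omega), neg_smul]
      exact vec_stdSeq (by omega) n
  have hsum : ∑ n ∈ s, (g n * (if n = 0 then 0 else -(1 / 2) : F)) • vecW F q n = 0 := by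
    have := congrArg vecL hg
    rw [map_sum, map_zero] at this
    rw [← this]
    refine Finset.sum_congr rfl fun n _ => ?_
    rw [map_smul, hv, smul_smul]
  have hg0 := linearIndependent_iff'.mp (linearIndependent_vecW (F := F) (by omega : 0 < q)) s _
    hsum
  have hpos : ∀ n ∈ s, n ≠ 0 → g n = 0 := by
    intro n hn hn0
    have := hg0 n hn
    rw [if_neg hn0] at this
    simpa [h2] using this
  intro n hn
  by_cases hn0 : n = 0
  · subst hn0
    rw [Finset.sum_eq_single_of_mem 0 hn fun m hm hm0 => by rw [hpos m hm hm0, zero_smul]] at hg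
    have h1 := LinearMap.congr_fun (congrArg SemiEnd.op hg) (vecW F q 0)
    have h1' : g 0 • opE F q (vecW F q 0) = 0 := h1
    rw [opE_vecW (by omega), smul_eq_zero] at h1'
    exact h1'.resolve_right (vecW_ne_zero (by omega) _)
  · exact hpos n hn hn0

theorem coe_stdSeq_extra (n : ℕ) :
    ((stdSeq (extraOne F q) (extraTwo F q) n : extraAlgebra F q) :
      SemiEnd (RatFunc F) (Fin q → RatFunc F)) =
      stdSeq (genOne F q) (genTwo F q) n :=
  map_stdSeq (extraAlgebra F q).incl n

theorem linearIndependent_stdSeq_extra (hF : IsOddCharPower F p q) :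
    LinearIndependent F fun n => stdSeq (extraOne F q) (extraTwo F q) (n + 1) := by
  refine LinearIndependent.of_comp (extraAlgebra F q).incl.toLinearMap ?_
  convert! linearIndependent_stdSeq_gen hF using 1
  funext n
  exact coe_stdSeq_extra (n + 1)

theorem stdSeq_extra_lie_snd (hF : IsOddCharPower F p q) (k : ℕ) (hk : 3 ≤ k) :
    ⁅stdSeq (extraOne F q) (extraTwo F q) k, extraTwo F q⁆ =
      extraCoeff F q k • stdSeq (extraOne F q) (extraTwo F q) (k + 2) := by
  apply Subtype.ext
  change ⁅(stdSeq (extraOne F q) (extraTwo F q) k).1, genTwo F q⁆ =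
    extraCoeff F q k • (stdSeq (extraOne F q) (extraTwo F q) (k + 2)).1
  rw [coe_stdSeq_extra, coe_stdSeq_extra]
  exact stdSeq_gen_lie_snd hF hk

theorem lieSpan_extra_eq_top (F : Type u) [Field F] (q : ℕ) :
    LieSubalgebra.lieSpan F (extraAlgebra F q) {extraOne F q, extraTwo F q} = ⊤ := by
  rw [eq_top_iff]
  rintro ⟨z, hz⟩ -
  have hz' := hz
  rw [extraAlgebra] at hz'
  induction hz' using LieSubalgebra.lieSpan_induction with
  | mem z hz' =>
    apply LieSubalgebra.subset_lieSpan
    rcases hz' with rfl | rfl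
    · exact Or.inl rfl
    · exact Or.inr rfl
  | zero => exact LieSubalgebra.zero_mem _
  | add a b ha hb h1 h2 => exact add_mem (h1 ha) (h2 hb)
  | smul c a ha h1 => exact LieSubalgebra.smul_mem _ c (h1 ha)
  | lie a b ha hb h1 h2 => exact LieSubalgebra.lie_mem _ (h1 ha) (h2 hb)

theorem stdSeq_extra_lie_eq_zero (hF : IsOddCharPower F p q) {m n : ℕ} (hm : q < m)
    (hn : q < n) : ⁅stdSeq (extraOne F q) (extraTwo F q) m,
      stdSeq (extraOne F q) (extraTwo F q) n⁆ = 0 := by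
  apply Subtype.ext
  rw [LieSubalgebra.coe_bracket, coe_stdSeq_extra, coe_stdSeq_extra]
  ext1
  · simp [op_stdSeq_eq_zero hF hm, op_stdSeq_eq_zero hF hn]
  · simp [op_stdSeq_eq_zero hF hm, op_stdSeq_eq_zero hF hn]

/-- The bracket is a multiple of e_{m+n}. For m + n > q that element has no operator part; for m + n
≤ q the multiple is a difference of coefficients below weight q, all of them zero. -/
theorem op_stdSeq_lie_stdSeq (hF : IsOddCharPower F p q) {m n : ℕ} (hm : 2 ≤ m) (hn : 2 ≤ n) :
    (⁅stdSeq (genOne F q) (genTwo F q) m, stdSeq (genOne F q) (genTwo F q) n⁆).op = 0 := by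
  obtain ⟨k, rfl⟩ : ∃ k, n = k + 2 := ⟨n - 2, by omega⟩
  rw [stdSeq_lie_stdSeq (stdSeq_lie_snd_eq_extension
    fun _ hk => stdSeq_gen_lie_snd hF hk) hm k, SemiEnd.op_smul]
  rcases Nat.lt_or_ge q (m + k + 2) with h | h
  · rw [op_stdSeq_eq_zero hF h, smul_zero]
  · rw [lieCoeff_eq_zero, zero_smul]
    intro j hj
    split_ifs with h2
    · rfl
    · exact extraCoeff_eq_zero (i := 0) (by omega) (by omega)

theorem derivedSeries_succ_le {L : Type v} [LieRing L] [LieAlgebra F L] (k : ℕ)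
    (S T : Submodule F L) (hS : (LieAlgebra.derivedSeries F L k).toSubmodule ≤ S)
    (h : ∀ a ∈ S, ∀ b ∈ S, ⁅a, b⁆ ∈ T) :
    (LieAlgebra.derivedSeries F L (k + 1)).toSubmodule ≤ T := by
  rw [LieAlgebra.derivedSeries_def, LieAlgebra.derivedSeriesOfIdeal_succ,
    ← LieAlgebra.derivedSeries_def, LieSubmodule.lieIdeal_oper_eq_linear_span', Submodule.span_le]
  rintro _ ⟨a, ha, b, hb, rfl⟩
  exact h a (hS ha) b (hS hb)

theorem lie_mem_of_mem_span {L : Type v} [LieRing L] [LieAlgebra F L] {s : Set L}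
    {T : Submodule F L} (h : ∀ a ∈ s, ∀ b ∈ s, ⁅a, b⁆ ∈ T) :
    ∀ a ∈ Submodule.span F s, ∀ b ∈ Submodule.span F s, ⁅a, b⁆ ∈ T := by
  intro a ha b hb
  induction ha using Submodule.span_induction with
  | mem a ha =>
    induction hb using Submodule.span_induction with
    | mem b hb => exact h a ha b hb
    | zero => simp
    | add b c _ _ h1 h2 => rw [lie_add]; exact add_mem h1 h2
    | smul c b _ h1 => rw [lie_smul]; exact Submodule.smul_mem _ _ h1
  | zero => simp
  | add a c _ _ h1 h2 => rw [add_lie]; exact add_mem h1 h2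
  | smul c a _ h1 => rw [smul_lie]; exact Submodule.smul_mem _ _ h1

/-- Three steps suffice: the derived algebra lies in the span of e_2, e_3, …, brackets of these have
no operator part, and V is abelian. -/
theorem isSolvable_extraAlgebra (hF : IsOddCharPower F p q) :
    LieAlgebra.IsSolvable (extraAlgebra F q) := by
  let e : ℕ → extraAlgebra F q := stdSeq (extraOne F q) (extraTwo F q)
  have htop : Submodule.span F (Set.range fun n => e (n + 1)) = ⊤ :=
    span_stdSeq_eq_top (lieSpan_extra_eq_top F q) (stdSeq_extra_lie_snd hF)
  let opL : extraAlgebra F q →ₗ[F] Module.End (RatFunc F) (Fin q → RatFunc F) :=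
    { toFun := fun z => z.1.op, map_add' := fun _ _ => rfl, map_smul' := fun _ _ => rfl }
  refine (LieAlgebra.isSolvable_iff F _).mpr ⟨3, ?_⟩
  have h1 := derivedSeries_succ_le (F := F) (L := extraAlgebra F q) 0
    (Submodule.span F (Set.range fun n => e (n + 1)))
    (Submodule.span F (Set.range fun n => e (n + 2))) (by rw [htop]; exact le_top) (by
      apply lie_mem_of_mem_span
      rintro _ ⟨m, rfl⟩ _ ⟨n, rfl⟩
      refine (Submodule.span_singleton_le_iff_mem _ _).mpr ?_
        (stdSeq_lie_mem_span (stdSeq_extra_lie_snd hF) (m + 1) (n + 1))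
      exact Submodule.subset_span ⟨m + n, by
        change e (m + n + 2) = e (m + 1 + (n + 1))
        congr 1
        ring⟩)
  have h2 := derivedSeries_succ_le 1 _ (LinearMap.ker opL) h1 (by
    apply lie_mem_of_mem_span
    rintro _ ⟨m, rfl⟩ _ ⟨n, rfl⟩
    rw [LinearMap.mem_ker]
    change (⁅(stdSeq (extraOne F q) (extraTwo F q) (m + 2)).1,
      (stdSeq (extraOne F q) (extraTwo F q) (n + 2)).1⁆).op = 0
    rw [coe_stdSeq_extra, coe_stdSeq_extra]
    exact op_stdSeq_lie_stdSeq hF (by omega) (by omega))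
  have h3 := derivedSeries_succ_le 2 _ ⊥ h2 (by
    intro a ha b hb
    rw [LinearMap.mem_ker] at ha hb
    have ha' : a.1.op = 0 := ha
    have hb' : b.1.op = 0 := hb
    rw [Submodule.mem_bot]
    apply Subtype.ext
    rw [LieSubalgebra.coe_bracket]
    ext1
    · simp [ha', hb']
    · simp [ha', hb'])
  exact (LieSubmodule.toSubmodule_eq_bot _).mp (le_bot_iff.mp h3)

end Construction

/-! ### Isomorphism with the model and the possible values of the coefficient -/

section Main

variable {F : Type u} [Field F] {p q : ℕ}

theorem existsUnique_extraAlgebra_lieHom (hF : IsOddCharPower F p q) {K : Type v} [LieRing K]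
    [LieAlgebra F K] {x y : K}
    (h : ∀ k : ℕ, 3 ≤ k → ⁅stdSeq x y k, y⁆ = extraCoeff F q k • stdSeq x y (k + 2)) :
    ∃! ψ : extraAlgebra F q →ₗ⁅F⁆ K, ψ (extraOne F q) = x ∧ ψ (extraTwo F q) = y :=
  existsUnique_lieHom (lieSpan_extra_eq_top F q) (stdSeq_extra_lie_snd hF)
    (linearIndependent_stdSeq_extra hF) h

theorem isInfiniteTypeTwo_extraAlgebra (hF : IsOddCharPower F p q) :
    ∃ 𝒜 : ℕ → Submodule F (extraAlgebra F q),
      IsInfiniteTypeTwo F 𝒜 ∧ IsStandardPair 𝒜 (extraOne F q) (extraTwo F q) := by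
  have hli := linearIndependent_stdSeq_extra hF
  exact ⟨_, isInfiniteTypeTwo_span_stdSeq (lieSpan_extra_eq_top F q) (stdSeq_extra_lie_snd hF) hli,
    Submodule.mem_span_singleton_self _, hli.ne_zero 0, Submodule.mem_span_singleton_self _,
    hli.ne_zero 1⟩

variable {L : Type v} [LieRing L] [LieAlgebra F L] {𝒜 : ℕ → Submodule F L} {x y : L}

/-- Replacing e_2 by c e_2 multiplies [e_q, e_2] by c^2 but e_{q+2} only by c, so c is the inverse
of the coefficient of [e_q, e_2]. -/
theorem IsInfiniteTypeTwo.exists_smul_snd (h : IsInfiniteTypeTwo F 𝒜)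
    (hs : IsStandardPair 𝒜 x y) (hF : IsOddCharPower F p q)
    (low : ∀ i : ℕ, 3 ≤ i → i < q → ⁅stdSeq x y i, y⁆ = 0) (hne : ⁅stdSeq x y q, y⁆ ≠ 0) :
    ∃ c : F, c ≠ 0 ∧
      (∀ i : ℕ, 3 ≤ i → i < q → ⁅stdSeq x (c • y) i, c • y⁆ = 0) ∧
      ⁅stdSeq x (c • y) q, c • y⁆ = stdSeq x (c • y) (q + 2) := by
  have h5 := hF.five_le
  obtain ⟨b, hb⟩ := h.toIsTypeTwo.exists_smul_stdSeq hs (h.lie_mem _ _ _ _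
    (hs.stdSeq_mem h.toIsTypeTwo q) hs.snd_mem)
  have hb0 : b ≠ 0 := by
    rintro rfl
    rw [zero_smul] at hb
    exact hne hb.symm
  refine ⟨b⁻¹, inv_ne_zero hb0, fun i h3 hi => ?_, ?_⟩
  · rw [stdSeq_smul_snd _ (by omega), smul_lie, lie_smul, low i h3 hi, smul_zero, smul_zero]
  · rw [stdSeq_smul_snd _ (by omega), stdSeq_smul_snd _ (by omega), smul_lie, lie_smul, ← hb,
      smul_smul b⁻¹ b, inv_mul_cancel₀ hb0, one_smul]

theorem IsInfiniteTypeTwo.stdSeq_lie_snd (h : IsInfiniteTypeTwo F 𝒜)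
    (hs : IsStandardPair 𝒜 x y) (hF : IsOddCharPower F p q)
    (low : ∀ i : ℕ, 3 ≤ i → i < q → ⁅stdSeq x y i, y⁆ = 0)
    (one : ⁅stdSeq x y q, y⁆ = stdSeq x y (q + 2)) (k : ℕ) (hk : 3 ≤ k) :
    ⁅stdSeq x y k, y⁆ = extraCoeff F q k • stdSeq x y (k + 2) := by
  have h5 := hF.five_le
  have hne : ∀ i, 1 ≤ i → stdSeq x y i ≠ 0 := fun i hi => h.stdSeq_ne_zero hs hi
  obtain ⟨β, hβ2, hβ⟩ := h.toIsTypeTwo.exists_coeff hs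
  -- Weight N + 1 is used in place of N because e_0 = 0.
  have H : ∀ N, IsLieSeq β N := fun N =>
    (isLieSeq_of_stdSeq_ne_zero hβ2 hβ (hne (N + 1) (by omega))).mono (Nat.le_succ N)
  rw [hβ k (by omega)]
  refine congrArg (· • _) ((isExtraUpTo_of_forall_isLieSeq hF H (fun i h3 hi => ?_) ?_ k).2 k hk
    le_rfl)
  · have := low i h3 hi
    rw [hβ i (by omega), smul_eq_zero] at this
    exact this.resolve_right (hne _ (by omega))
  · rw [hβ q (by omega)] at one
    exact smul_left_injective F (hne (q + 2) (by omega)) (one.trans (one_smul F _).symm)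

/-- Both algebras are presented by the same relations. The homomorphisms in the two directions match
the e_i, which span, and so they are mutually inverse. -/
theorem IsInfiniteTypeTwo.exists_lieEquiv (h : IsInfiniteTypeTwo F 𝒜)
    (hs : IsStandardPair 𝒜 x y) (hF : IsOddCharPower F p q)
    (hrel : ∀ k : ℕ, 3 ≤ k → ⁅stdSeq x y k, y⁆ = extraCoeff F q k • stdSeq x y (k + 2)) :
    ∃ φ : L ≃ₗ⁅F⁆ extraAlgebra F q,
      ∀ i : ℕ, φ (stdSeq x y i) = stdSeq (extraOne F q) (extraTwo F q) i := by
  obtain ⟨f, ⟨hfx, hfy⟩, -⟩ := existsUnique_lieHom (h.lieSpan_eq_top hs) hrel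
    (h.linearIndependent_stdSeq hs) (stdSeq_extra_lie_snd hF)
  obtain ⟨g, ⟨hgx, hgy⟩, -⟩ := existsUnique_extraAlgebra_lieHom hF hrel
  have hf : ∀ i, f (stdSeq x y i) = stdSeq (extraOne F q) (extraTwo F q) i := fun i => by
    rw [map_stdSeq, hfx, hfy]
  have hg : ∀ i, g (stdSeq (extraOne F q) (extraTwo F q) i) = stdSeq x y i := fun i => by
    rw [map_stdSeq, hgx, hgy]
  have hgf : (g : extraAlgebra F q →ₗ[F] L) ∘ₗ (f : L →ₗ[F] extraAlgebra F q) =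
      LinearMap.id := by
    refine LinearMap.ext_on_range (span_stdSeq_eq_top (h.lieSpan_eq_top hs) hrel) fun n => ?_
    change g (f _) = _
    rw [hf, hg]
    rfl
  have hfg : (f : L →ₗ[F] extraAlgebra F q) ∘ₗ (g : extraAlgebra F q →ₗ[F] L) =
      LinearMap.id := by
    refine LinearMap.ext_on_range
      (span_stdSeq_eq_top (lieSpan_extra_eq_top F q) (stdSeq_extra_lie_snd hF)) fun n => ?_
    change f (g _) = _
    rw [hg, hf]
    rfl
  have hbij : Function.Bijective f :=
    Function.bijective_iff_has_inverse.mpr ⟨g, LinearMap.congr_fun hgf, LinearMap.congr_fun hfg⟩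
  exact ⟨LieEquiv.ofBijective f hbij, hf⟩

/-- The possible values of the first undetermined coefficient. -/
theorem IsTypeTwo.coeff_dichotomy (h : IsTypeTwo F 𝒜) (hs : IsStandardPair 𝒜 x y)
    (hF : IsOddCharPower F p q) {n : ℕ} {lam : F} (hn : 1 ≤ n)
    (hrel : ∀ k : ℕ, 3 ≤ k → k ≤ (2 * n - 1) * q + 1 →
      ⁅stdSeq x y k, y⁆ = extraCoeff F q k • stdSeq x y (k + 2))
    (hlam : ⁅stdSeq x y (2 * n * q + 1), y⁆ = lam • stdSeq x y (2 * n * q + 3)) :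
    (n = 1 → stdSeq x y (3 * q + 3) ≠ 0 → lam = -(1 / 2) ∨ (lam = -(1 / 4) ∧ p ≠ 3)) ∧
    (stdSeq x y ((2 * n + 2) * q + 2) ≠ 0 → lam = -(1 / 2) ∨ (lam = -(1 / 4) ∧ p ≠ 3)) ∧
    (lam = -(1 / 4) →
      stdSeq x y ((2 * n + p - 2) * q + 2) = 0 ∧ LieRing.IsNilpotent L) := by
  have h5 := hF.five_le
  have h3p : 3 ≤ p := by
    have := hF.prime.two_le
    have := hF.ne_two
    omega
  have hnq : q ≤ n * q := Nat.le_mul_of_pos_left q hn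
  have e2 : 2 * n * q = n * q + n * q := by ring
  have e3 : (2 * n - 1) * q + q = 2 * n * q := by
    rw [← Nat.succ_mul]
    congr 1
    omega
  obtain ⟨β, hβ2, hβ⟩ := h.exists_coeff hs
  -- A relation of weight k determines β_k only while e_{k+2} ≠ 0. The coefficients strictly between
  -- (2n-1)q + 1 and 2nq + 1 are not given; `IsLieSeq.extend_odd_level` supplies them.
  have key : ∀ N, 2 * n * q + 3 ≤ N → stdSeq x y N ≠ 0 →
      IsLieSeq β N ∧ IsExtraUpTo β q (2 * n * q) ∧ β (2 * n * q + 1) = lam := by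
    intro N hN hne
    have H := isLieSeq_of_stdSeq_ne_zero hβ2 hβ hne
    have hval : ∀ k c, 2 ≤ k → k + 2 ≤ N → ⁅stdSeq x y k, y⁆ = c • stdSeq x y (k + 2) →
        β k = c := by
      intro k c hk hkN hc
      rw [hβ k hk] at hc
      exact smul_left_injective F (stdSeq_ne_zero_of_le (by omega) hkN hne) hc
    refine ⟨H, H.extend_odd_level hF hn (by omega) ⟨hβ2, fun k h3 hk => ?_⟩, ?_⟩
    · exact hval k _ (by omega) (by omega) (hrel k h3 hk)
    · exact hval _ _ (by omega) (by omega) hlam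
  have quarter : lam = -(1 / 4) → stdSeq x y ((2 * n + p - 2) * q + 2) = 0 := by
    intro hl
    by_contra hne
    have e4 : (2 * n + 1) * q ≤ (2 * n + p - 2) * q := Nat.mul_le_mul_right q (by omega)
    rw [add_mul, one_mul] at e4
    obtain ⟨H, hE, hβl⟩ := key _ (by omega) hne
    exact lt_irrefl _ (H.lt_of_eq_neg_quarter hF hn hE (hβl.trans hl))
  -- For p = 3 the weight at which -1/4 forces vanishing is (2n + 1)q + 2, too low for e_N to
  -- survive.
  have not_three : ∀ N, (2 * n + 1) * q + 2 ≤ N → stdSeq x y N ≠ 0 → lam = -(1 / 4) → p ≠ 3 := by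
    rintro N hN hne hl rfl
    refine stdSeq_ne_zero_of_le (by omega) hN hne ?_
    have := quarter hl
    rwa [show 2 * n + 3 - 2 = 2 * n + 1 by omega] at this
  refine ⟨?_, ?_, fun hl => ⟨quarter hl, ?_⟩⟩
  · rintro rfl hne
    obtain ⟨H, hE, hβl⟩ := key _ (by omega) hne
    rw [← hβl]
    refine (H.eq_or_eq_of_first hF le_rfl hE).imp_right fun hl => ⟨hl, ?_⟩
    exact not_three _ (by omega) hne (hβl.symm.trans hl)
  · intro hne
    have e4 : (2 * n + 2) * q = 2 * n * q + 2 * q := by ring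
    obtain ⟨H, hE, hβl⟩ := key _ (by omega) hne
    rw [← hβl]
    refine (H.eq_or_eq hF hn le_rfl hE).imp_right fun hl => ⟨hl, ?_⟩
    refine not_three _ ?_ hne (hβl.symm.trans hl)
    rw [add_mul, one_mul]
    omega
  · have e4 : (2 * n + 1) * q ≤ (2 * n + p - 2) * q := Nat.mul_le_mul_right q (by omega)
    rw [add_mul, one_mul] at e4
    exact h.isNilpotent hs (by omega) (quarter hl)

end Main

end ExtraLie

end

open ExtraLie in
theorem mainTheorem6 (p s q : ℕ) (hp : p.Prime) (hp2 : p ≠ 2) (hq : q = p ^ s) (hq3 : 3 < q)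
    (F : Type u) [Field F] [CharP F p] :
    -- existence: the algebra constructed inside `V + End(V)` over `F(t)`
    (∃ 𝒜 : ℕ → Submodule F (extraAlgebra F q),
      IsInfiniteTypeTwo F 𝒜 ∧ IsStandardPair 𝒜 (extraOne F q) (extraTwo F q)) ∧
    (∀ k : ℕ, 3 ≤ k →
      ⁅stdSeq (extraOne F q) (extraTwo F q) k, extraTwo F q⁆ =
        extraCoeff F q k • stdSeq (extraOne F q) (extraTwo F q) (k + 2)) ∧
    LieAlgebra.IsSolvable (extraAlgebra F q) ∧
    -- the relations define it: it is presented by the generators `e_1`, `e_2` and the relations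
    (∀ (K : Type v) [LieRing K] [LieAlgebra F K] (x y : K),
      (∀ k : ℕ, 3 ≤ k → ⁅stdSeq x y k, y⁆ = extraCoeff F q k • stdSeq x y (k + 2)) →
      ∃! ψ : extraAlgebra F q →ₗ⁅F⁆ K, ψ (extraOne F q) = x ∧ ψ (extraTwo F q) = y) ∧
    -- rescaling: `[e_q, e_2] ≠ 0` may be normalized to `[e_q, e_2] = e_{q+2}`
    (∀ (L : Type v) [LieRing L] [LieAlgebra F L] (𝒜 : ℕ → Submodule F L) (x y : L),
      IsInfiniteTypeTwo F 𝒜 → IsStandardPair 𝒜 x y →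
      (∀ i : ℕ, 3 ≤ i → i < q → ⁅stdSeq x y i, y⁆ = 0) →
      ⁅stdSeq x y q, y⁆ ≠ 0 →
      ∃ c : F, c ≠ 0 ∧
        (∀ i : ℕ, 3 ≤ i → i < q → ⁅stdSeq x (c • y) i, c • y⁆ = 0) ∧
        ⁅stdSeq x (c • y) q, c • y⁆ = stdSeq x (c • y) (q + 2)) ∧
    -- uniqueness, remaining relations and solubility
    (∀ (L : Type v) [LieRing L] [LieAlgebra F L] (𝒜 : ℕ → Submodule F L) (x y : L),
      IsInfiniteTypeTwo F 𝒜 → IsStandardPair 𝒜 x y →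
      (∀ i : ℕ, 3 ≤ i → i < q → ⁅stdSeq x y i, y⁆ = 0) →
      ⁅stdSeq x y q, y⁆ = stdSeq x y (q + 2) →
      (∀ k : ℕ, 3 ≤ k → ⁅stdSeq x y k, y⁆ = extraCoeff F q k • stdSeq x y (k + 2)) ∧
      (∀ m n : ℕ, q < m → q < n → ⁅stdSeq x y m, stdSeq x y n⁆ = 0) ∧
      LieAlgebra.IsSolvable L ∧
      ∃ φ : L ≃ₗ⁅F⁆ extraAlgebra F q,
        ∀ i : ℕ, φ (stdSeq x y i) = stdSeq (extraOne F q) (extraTwo F q) i) ∧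
    -- the coefficient `lam` of `[e_{2nq+1}, e_2]`, in a possibly finite-dimensional algebra
    (∀ (L : Type v) [LieRing L] [LieAlgebra F L] (𝒜 : ℕ → Submodule F L) (x y : L),
      IsTypeTwo F 𝒜 → IsStandardPair 𝒜 x y →
      ∀ (n : ℕ) (lam : F), 1 ≤ n →
      (∀ k : ℕ, 3 ≤ k → k ≤ (2 * n - 1) * q + 1 →
        ⁅stdSeq x y k, y⁆ = extraCoeff F q k • stdSeq x y (k + 2)) →
      ⁅stdSeq x y (2 * n * q + 1), y⁆ = lam • stdSeq x y (2 * n * q + 3) →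
      (n = 1 → stdSeq x y (3 * q + 3) ≠ 0 → lam = -(1 / 2) ∨ (lam = -(1 / 4) ∧ p ≠ 3)) ∧
      (stdSeq x y ((2 * n + 2) * q + 2) ≠ 0 → lam = -(1 / 2) ∨ (lam = -(1 / 4) ∧ p ≠ 3)) ∧
      (lam = -(1 / 4) →
        stdSeq x y ((2 * n + p - 2) * q + 2) = 0 ∧ LieRing.IsNilpotent L)) := by
  have hF : IsOddCharPower F p q := ⟨hp, hp2, inferInstance, ⟨s, hq⟩, hq3⟩
  refine ⟨isInfiniteTypeTwo_extraAlgebra hF, stdSeq_extra_lie_snd hF, isSolvable_extraAlgebra hF,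
    fun K _ _ x y h => existsUnique_extraAlgebra_lieHom hF h,
    fun L _ _ 𝒜 x y h hs low hne => h.exists_smul_snd hs hF low hne,
    fun L _ _ 𝒜 x y h hs low one => ?_,
    fun L _ _ 𝒜 x y h hs n lam hn hrel hlam => h.coeff_dichotomy hs hF hn hrel hlam⟩
  have hrel := h.stdSeq_lie_snd hs hF low one
  obtain ⟨φ, hφ⟩ := h.exists_lieEquiv hs hF hrel
  refine ⟨hrel, fun m n hm hn => φ.injective ?_, ?_, φ, hφ⟩
  · change φ _ = φ 0
    rw [LieEquiv.map_lie, hφ, hφ, stdSeq_extra_lie_eq_zero hF hm hn]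
    exact (map_zero (φ.toLieHom : L →ₗ[F] extraAlgebra F q)).symm
  · have := isSolvable_extraAlgebra hF
    exact Function.Injective.lieAlgebra_isSolvable (f := φ.toLieHom) φ.injective
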